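/- Let two users have channel gains $X_1,X_2$ that are i.i.d. uniform on $[0,1]$, and let $Y_1=\min(X_1,X_2)$, $Y_2=\max(X_1,X_2)$. *Delay.* In every minislot a strategy selects, as a function of the feedback received in the earlier minislots, a contention range $(a,b]$; the users with gain in $(a,b]$ transmit, and the feedback is $0$, $1$ or $e$ according to whether no user, exactly one user, or both users transmit. Contention ends with the first feedback $1$; the delay is the number of minislots used, the last one included ($\infty$ if feedback $1$ never occurs). A maximal probability allocation (MPA) strategy is one which, after every feedback history without a $1$, uses a range that maximizes, among all ranges, the conditional probability (given that history) that the user with the highest gain is the only one to transmit. The opportunistic splitting algorithm for two users starts with the range $(\tfrac12,1]$ and, when both gains are known to lie in an interval with endpoints $l<u$, uses the range $(\tfrac{l+u}2,u]$. Then this algorithm is an MPA strategy; for every MPA strategy, almost surely a feedback $1$ occurs and the lone transmitter at the first such feedback is the user with the highest gain; every MPA strategy has expected delay $2$; and every strategy has expected delay at least $2$. *Entropy.* A code is a measurable map $C$ that assigns to every pair $0\le y_1<y_2\le 1$ a threshold $C(y_1,y_2)$ with $y_1\le C(y_1,y_2)<y_2$ and for which $Y=C(Y_1,Y_2)$ has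 a discrete distribution; its entropy is $-\sum_y \Pr(Y=y)\log_2\Pr(Y=y)\in[0,\infty]$. A sequence of MPA thresholds is a sequence $(t_k)_{k\ge1}$ in $[0,1]$ such that, for every $k$, $t=t_k$ maximizes over $t\in[0,1]$ the conditional probability of $Y_1\le t<Y_2$ given that none of $t_1,\dots,t_{k-1}$ lies in $[Y_1,Y_2)$. Its code assigns to $(y_1,y_2)$ the first $t_k$ with $y_1\le t_k<y_2$. Then the dyadic sequence $\tfrac12,\tfrac34,\tfrac14,\tfrac78,\tfrac58,\tfrac38,\tfrac18,\dots$ is a sequence of MPA thresholds, and every sequence of MPA thresholds has the same set of terms as this one; the code of every sequence of MPA thresholds is a code in the above sense, with entropy exactly $3$ bits; and every code has entropy at least $3$ bits. Finally, the two descriptions agree: for every MPA strategy and every sequence of MPA thresholds, almost surely the lower endpoint $a$ of the range $(a,b]$ used in the minislot of the first feedback $1$ equals the threshold that the code assigns to $(Y_1,Y_2)$. -/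

import Mathlib

open MeasureTheory ProbabilityTheory
open scoped ENNReal

noncomputable section

namespace Contention

/-- Ternary feedback of the base station at the end of a minislot:
`idle` is `0` (no transmission), `success` is `1` (exactly one), `collision` is `e`. -/
inductive Feedback where
  | idle
  | success
  | collision

/-- A contention range `(r.1, r.2]`: the users whose gain falls in it transmit. -/
abbrev Range : Type := ℝ × ℝ

/-- A strategy picks the contention range of the next minislot from the feedback received
in the previous minislots (oldest first). -/
abbrev Strategy : Type := List Feedback → Range

open Classical in
/-- Feedback of a minislot with contention range `r`, for two users with gains `x 0`, `x 1`. -/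
def feedback (r : Range) (x : Fin 2 → ℝ) : Feedback :=
  match (Finset.univ.filter fun i => x i ∈ Set.Ioc r.1 r.2).card with
  | 0 => .idle
  | 1 => .success
  | _ => .collision

/-- The feedback of the first `n` minislots. (What happens after the first `success`, when
contention is over, plays no role below.) -/
def history (σ : Strategy) (x : Fin 2 → ℝ) : ℕ → List Feedback
  | 0 => []
  | n + 1 => history σ x n ++ [feedback (σ (history σ x n)) x]

/-- The range `r` identifies the best user: exactly one user transmits, and it is the one with
the (strictly) highest gain. -/
def IdentifiesBest (r : Range) (x : Fin 2 → ℝ) : Prop :=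
  ∃ i, x i ∈ Set.Ioc r.1 r.2 ∧ ∀ j, j ≠ i → x j ∉ Set.Ioc r.1 r.2 ∧ x j < x i

/-- The first minislot with feedback `success` is the one with index `n` (counted from `0`). -/
def FirstSuccess (σ : Strategy) (x : Fin 2 → ℝ) (n : ℕ) : Prop :=
  feedback (σ (history σ x n)) x = .success ∧
    ∀ m < n, feedback (σ (history σ x m)) x ≠ .success

/-- The number of minislots used up to and including the first `success`
(`∞` if there is none). -/
def delay (σ : Strategy) (x : Fin 2 → ℝ) : ℝ≥0∞ :=
  ⨅ (n : ℕ) (_ : FirstSuccess σ x n), ((n : ℝ≥0∞) + 1)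

/-- The ordered gains `Y₁ ≤ Y₂`. -/
def ordered (x : Fin 2 → ℝ) : ℝ × ℝ := (min (x 0) (x 1), max (x 0) (x 1))

/-- `t` separates the ordered pair `q`: `q.1 ≤ t < q.2`. -/
def Separates (t : ℝ) (q : ℝ × ℝ) : Prop := q.1 ≤ t ∧ t < q.2

/-- State of the opportunistic splitting algorithm. -/
structure OSAState where
  low : ℝ
  min : ℝ
  max : ℝ

open Classical in
/-- One update of the opportunistic splitting algorithm for `N` users. -/
def osaStep (N : ℕ) (s : OSAState) : Feedback → OSAState
  | .collision => ⟨s.min, (s.min + s.max) / 2, s.max⟩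
  | .idle =>
      if s.low ≠ 0 then ⟨s.low, (s.low + s.min) / 2, s.min⟩
      else ⟨s.low, s.min * (1 - 1 / N), s.min⟩
  | .success => s

/-- The opportunistic splitting algorithm for `N` users, as a strategy. -/
def osa (N : ℕ) : Strategy := fun h =>
  let s := h.foldl (osaStep N) ⟨0, 1 - 1 / N, 1⟩
  (s.min, s.max)

section Random

variable {Ω : Type*} [MeasurableSpace Ω]

/-- Expected number of minislots needed to resolve contention. -/
def expectedDelay (P : Measure Ω) (X : Fin 2 → Ω → ℝ) (σ : Strategy) : ℝ≥0∞ :=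
  ∫⁻ ω, delay σ (fun i => X i ω) ∂P

/-- Maximal probability allocation as a strategy: as long as contention is unresolved, the next
range maximizes, among all ranges, the conditional probability of identifying the best user,
given the feedback received so far. -/
def IsMPAStrategy (P : Measure Ω) (X : Fin 2 → Ω → ℝ) (σ : Strategy) : Prop :=
  ∀ h : List Feedback, Feedback.success ∉ h → ∀ r : Range,
    P[|{ω | history σ (fun i => X i ω) h.length = h}] {ω | IdentifiesBest r (fun i => X i ω)} ≤
    P[|{ω | history σ (fun i => X i ω) h.length = h}] {ω | IdentifiesBest (σ h) (fun i => X i ω)}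

/-- The event that `(Y₁, Y₂)` is separated by none of `y 0, …, y (k - 1)`. -/
def unresolved (X : Fin 2 → Ω → ℝ) (y : ℕ → ℝ) (k : ℕ) : Set Ω :=
  {ω | ∀ j < k, ¬ Separates (y j) (ordered fun i => X i ω)}

/-- Maximal probability allocation as a list of thresholds: `y k` maximizes over `[0,1]` the
conditional probability of separating `(Y₁, Y₂)`, given that no earlier threshold does. -/
def IsMPAThresholds (P : Measure Ω) (X : Fin 2 → Ω → ℝ) (y : ℕ → ℝ) : Prop :=
  ∀ k, y k ∈ Set.Icc (0 : ℝ) 1 ∧ ∀ t ∈ Set.Icc (0 : ℝ) 1,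
    P[|unresolved X y k] {ω | Separates t (ordered fun i => X i ω)} ≤
    P[|unresolved X y k] {ω | Separates (y k) (ordered fun i => X i ω)}

/-- The threshold random variable `Y = C(Y₁, Y₂)` of a code `C`. -/
def threshold (X : Fin 2 → Ω → ℝ) (C : ℝ × ℝ → ℝ) (ω : Ω) : ℝ := C (ordered fun i => X i ω)

/-- A code: a measurable assignment of a separating threshold to every pair
`0 ≤ y₁ < y₂ ≤ 1`, whose threshold random variable is discrete. (Values at other arguments
are irrelevant; pairs with `y₁ = y₂` have no separating threshold and probability zero.) -/
structure IsCode (P : Measure Ω) (X : Fin 2 → Ω → ℝ) (C : ℝ × ℝ → ℝ) : Prop where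
  measurable : Measurable C
  separates : ∀ y₁ y₂ : ℝ, 0 ≤ y₁ → y₁ < y₂ → y₂ ≤ 1 → Separates (C (y₁, y₂)) (y₁, y₂)
  discrete : ∃ S : Set ℝ, S.Countable ∧ ∀ᵐ ω ∂P, threshold X C ω ∈ S

/-- Entropy, in bits, of a discrete real random variable; it may be `∞`. -/
def entropyBits (P : Measure Ω) (Y : Ω → ℝ) : ℝ≥0∞ :=
  ∑' y : ℝ, ENNReal.ofReal (-(P.real (Y ⁻¹' {y}) * Real.logb 2 (P.real (Y ⁻¹' {y}))))

end Random

open Classical in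
/-- The code of a list of thresholds: every pair gets the first threshold that separates it
(and the default `0` if there is none). -/
def firstThresholdCode (y : ℕ → ℝ) (q : ℝ × ℝ) : ℝ :=
  if h : ∃ k, Separates (y k) q then y (Nat.find h) else 0

/-- The dyadic thresholds `1/2, 3/4, 1/4, 7/8, 5/8, 3/8, 1/8, …`. -/
def dyadicThreshold (k : ℕ) : ℝ :=
  (2 * (2 ^ (Nat.log 2 (k + 1) + 1) - ((k : ℝ) + 1)) - 1) / 2 ^ (Nat.log 2 (k + 1) + 1)

end Contention

end

/-! Delay. The expected delay is the sum over `n` of the probability that the first `n` feedbacks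
contain no success. Attach to each `t` in `[0,1]` the word of `n` feedbacks that two users of equal
gain `t` would cause. It never contains a success, so at most `2^n` words occur, and they partition
`[0,1]`. Two gains with the same word cause that word themselves. The tail probability is therefore
at least the sum of the squared cell lengths, which is at least `2^(-n)` by Cauchy–Schwarz
(`le_prob_success_notMem_history`); these bounds sum to `2`. Halving attains them. Maximal
allocation forces halving: when both gains lie in `(l,u]`, a range `(a,b]` with `l ≤ a ≤ b ≤ u`
isolates the best user with probability proportional to `(a-l)(b-a)`, maximal only at the midpoint
with `b = u`. Induction on the history gives `isMPAStrategy_iff`.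

Entropy. The same optimization in every dyadic cell shows that maximal thresholds are the
enumerations of the dyadic fractions level by level (`isMPAThresholds_iff`). Each of the `2^n`
values of level `n ≥ 0` has probability `2^(-2n-1)`, and the entropy is the sum of `(2n+1)/2^(n+1)`,
which is `3`.

For the lower bound, the surprise `-log₂ P(Y = value)` is integrated over the event that both gains
lie in `(l,u]`; up to a small error the result is at least `(u-l)² (3 - log₂ m)` with `m = P(Y ∈
(l,u))` (`budget_le_setLIntegral_surprise`). The proof cuts at the heaviest atom `t` of `Y` in
`(l,u)`. Pairs in the box split by `t` have surprise at least that of `t`; the other pairs fall into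
two smaller boxes, whose thresholds have disjoint ranges. The recursion closes by Gibbs' inequality
and `h(s) ≥ 4s(1-s)` for the binary entropy `h` in bits (`split_budget`).

Agreement. Among the dyadic fractions separating two gains, the one of lowest level is the midpoint
of the smallest dyadic interval containing both, and that is where bisection stops. -/

noncomputable section

namespace Contention

/-! ### The joint law of two independent uniform gains -/

section Events

variable {Ω : Type*} {X : Fin 2 → Ω → ℝ}

/-- Both gains lie in `(l, u]`. -/
def box (X : Fin 2 → Ω → ℝ) (l u : ℝ) : Set Ω := {ω | ∀ i, X i ω ∈ Set.Ioc l u}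

/-- The threshold `t` separates the gains, which lie in `(l, u]`. -/
def split (X : Fin 2 → Ω → ℝ) (l t u : ℝ) : Set Ω :=
  {ω | X 0 ω ∈ Set.Ioc l t ∧ X 1 ω ∈ Set.Ioc t u} ∪ {ω | X 0 ω ∈ Set.Ioc t u ∧ X 1 ω ∈ Set.Ioc l t}

lemma mem_split_iff {l t u : ℝ} {ω : Ω} :
    ω ∈ split X l t u ↔ (∀ i, l < X i ω ∧ X i ω ≤ u) ∧
      Separates t (ordered fun i => X i ω) := by
  simp only [split, Separates, ordered, Set.mem_union, Set.mem_ofPred_eq, Set.mem_Ioc,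
    Fin.forall_fin_two, min_le_iff, lt_max_iff]
  constructor
  · rintro (⟨⟨_, _⟩, _, _⟩ | ⟨⟨_, _⟩, _, _⟩)
    · exact ⟨⟨⟨by assumption, by linarith⟩, by linarith, by assumption⟩, .inl (by assumption),
        .inr (by assumption)⟩
    · exact ⟨⟨⟨by linarith, by assumption⟩, by assumption, by linarith⟩, .inr (by assumption),
        .inl (by assumption)⟩
  · rintro ⟨⟨⟨_, _⟩, _, _⟩, h1 | h1, h2 | h2⟩
    · linarith
    · exact .inl ⟨⟨by assumption, h1⟩, h2, by assumption⟩
    · exact .inr ⟨⟨h2, by assumption⟩, by assumption, h1⟩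
    · linarith

lemma split_subset_box {l t u : ℝ} : split X l t u ⊆ box X l u := fun _ h =>
  (mem_split_iff.1 h).1

end Events

section Law

variable {Ω : Type*} [MeasurableSpace Ω] {P : Measure Ω} {X : Fin 2 → Ω → ℝ}

/-- The two gains are measurable, and their joint law is Lebesgue measure on the unit square. -/
structure IsUniformPair (P : Measure Ω) (X : Fin 2 → Ω → ℝ) : Prop where
  measurable : ∀ i, Measurable (X i)
  map_eq : P.map (fun ω => (X 0 ω, X 1 ω)) =
    (volume.restrict (Set.Icc (0 : ℝ) 1)).prod (volume.restrict (Set.Icc (0 : ℝ) 1))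

lemma isUniformPair_of_iIndepFun [IsProbabilityMeasure P] (hmeas : ∀ i, Measurable (X i))
    (hunif : ∀ i, pdf.IsUniform (X i) (Set.Icc (0 : ℝ) 1) P volume) (hindep : iIndepFun X P) :
    IsUniformPair P X := by
  refine ⟨hmeas, ?_⟩
  have h01 : IndepFun (X 0) (X 1) P := hindep.indepFun (by decide)
  rw [(indepFun_iff_map_prod_eq_prod_map_map (hmeas 0).aemeasurable
    (hmeas 1).aemeasurable).1 h01]
  have h (i : Fin 2) : P.map (X i) = volume.restrict (Set.Icc (0 : ℝ) 1) := by
    have := hunif i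
    rw [pdf.IsUniform] at this
    rw [this, ProbabilityTheory.cond]
    simp
  rw [h 0, h 1]

namespace IsUniformPair

variable (hX : IsUniformPair P X)
include hX

lemma prob_mem {S : Set (ℝ × ℝ)} (hS : MeasurableSet S) :
    P {ω | (X 0 ω, X 1 ω) ∈ S} =
      ((volume.restrict (Set.Icc (0 : ℝ) 1)).prod (volume.restrict (Set.Icc (0 : ℝ) 1))) S := by
  rw [← hX.map_eq, Measure.map_apply ((hX.measurable 0).prodMk (hX.measurable 1)) hS]
  rfl

lemma prob_mem_mem {A B : Set ℝ} (hA : MeasurableSet A) (hB : MeasurableSet B) :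
    P {ω | X 0 ω ∈ A ∧ X 1 ω ∈ B} =
      volume (A ∩ Set.Icc 0 1) * volume (B ∩ Set.Icc 0 1) := by
  have := hX.prob_mem (hA.prod hB)
  rw [Measure.prod_prod, Measure.restrict_apply hA, Measure.restrict_apply hB] at this
  exact this

lemma prob_ioc_ioc {a b c d : ℝ} (ha : 0 ≤ a) (hab : a ≤ b) (hb : b ≤ 1) (hc : 0 ≤ c)
    (hd : d ≤ 1) :
    P {ω | X 0 ω ∈ Set.Ioc a b ∧ X 1 ω ∈ Set.Ioc c d} =
      ENNReal.ofReal ((b - a) * (d - c)) := by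
  have sub {a b : ℝ} (ha : 0 ≤ a) (hb : b ≤ 1) : Set.Ioc a b ∩ Set.Icc 0 1 = Set.Ioc a b :=
    Set.inter_eq_left.2 fun x hx => ⟨ha.trans hx.1.le, hx.2.trans hb⟩
  rw [hX.prob_mem_mem measurableSet_Ioc measurableSet_Ioc, sub ha hb, sub hc hd,
    Real.volume_Ioc, Real.volume_Ioc, ENNReal.ofReal_mul (by linarith)]

/-- The gain `0` lies in none of the half-open intervals of the bisection. Discarding it here lets
the later arguments run pointwise. -/
lemma ae_mem_Ioc : ∀ᵐ ω ∂P, ∀ i, X i ω ∈ Set.Ioc (0 : ℝ) 1 := by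
  have h0 := hX.prob_mem_mem (A := (Set.Ioc (0 : ℝ) 1)ᶜ) measurableSet_Ioc.compl
    MeasurableSet.univ
  have h1 := hX.prob_mem_mem (B := (Set.Ioc (0 : ℝ) 1)ᶜ) MeasurableSet.univ
    measurableSet_Ioc.compl
  have hz : volume ((Set.Ioc (0 : ℝ) 1)ᶜ ∩ Set.Icc 0 1) = 0 := by
    refine measure_mono_null (t := {0}) ?_ (by simp)
    rintro x ⟨hx, h0x, hx1⟩
    by_contra hne
    exact hx ⟨lt_of_le_of_ne h0x (Ne.symm hne), hx1⟩
  rw [hz, zero_mul] at h0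
  rw [hz, mul_zero] at h1
  rw [ae_all_iff, Fin.forall_fin_two]
  constructor
  · rw [ae_iff]; simpa using h0
  · rw [ae_iff]; simpa using h1

lemma ae_ne : ∀ᵐ ω ∂P, X 0 ω ≠ X 1 ω := by
  have h := hX.prob_mem (S := {q | q.1 = q.2}) (measurableSet_eq_fun measurable_fst measurable_snd)
  rw [ae_iff]
  simp only [ne_eq, not_not]
  refine h.trans ?_
  rw [Measure.measure_prod_null (measurableSet_eq_fun measurable_fst measurable_snd)]
  refine Filter.Eventually.of_forall fun x => ?_
  have : Prod.mk x ⁻¹' {q : ℝ × ℝ | q.1 = q.2} = {x} := by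
    ext y; simp [eq_comm]
  simp [this]

end IsUniformPair

lemma measurableSet_box (hX : ∀ i, Measurable (X i)) (l u : ℝ) : MeasurableSet (box X l u) := by
  have : box X l u = ⋂ i, X i ⁻¹' Set.Ioc l u := by ext; simp [box]
  rw [this]
  exact MeasurableSet.iInter fun i => hX i measurableSet_Ioc

lemma measurableSet_split (hX : ∀ i, Measurable (X i)) (l t u : ℝ) :
    MeasurableSet (split X l t u) :=
  ((hX 0 measurableSet_Ioc).inter (hX 1 measurableSet_Ioc)).union
    ((hX 0 measurableSet_Ioc).inter (hX 1 measurableSet_Ioc))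

lemma measurableSet_separates (hX : ∀ i, Measurable (X i)) (t : ℝ) :
    MeasurableSet {ω | Separates t (ordered fun i => X i ω)} :=
  (measurableSet_le ((hX 0).min (hX 1)) measurable_const).inter
    (measurableSet_lt measurable_const ((hX 0).max (hX 1)))

lemma measurable_ordered (hX : ∀ i, Measurable (X i)) :
    Measurable fun ω => ordered fun i => X i ω :=
  ((hX 0).min (hX 1)).prodMk ((hX 0).max (hX 1))

lemma IsUniformPair.prob_box (hX : IsUniformPair P X) {l u : ℝ} (hl : 0 ≤ l) (hlu : l ≤ u)
    (hu : u ≤ 1) : P (box X l u) = ENNReal.ofReal ((u - l) ^ 2) := by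
  rw [sq, ← hX.prob_ioc_ioc hl hlu hu hl hu]
  simp only [box, Fin.forall_fin_two]

lemma IsUniformPair.prob_split (hX : IsUniformPair P X) {l t u : ℝ} (hl : 0 ≤ l) (hlt : l ≤ t)
    (htu : t ≤ u) (hu : u ≤ 1) :
    P (split X l t u) = ENNReal.ofReal (2 * ((t - l) * (u - t))) := by
  have hm : MeasurableSet {ω | X 0 ω ∈ Set.Ioc t u ∧ X 1 ω ∈ Set.Ioc l t} :=
    (hX.measurable 0 measurableSet_Ioc).inter (hX.measurable 1 measurableSet_Ioc)
  rw [split, measure_union _ hm,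
    hX.prob_ioc_ioc hl hlt (htu.trans hu) (hl.trans hlt) hu,
    hX.prob_ioc_ioc (hl.trans hlt) htu hu hl (htu.trans hu), ← ENNReal.ofReal_add]
  · congr 1; ring
  · exact mul_nonneg (by linarith) (by linarith)
  · exact mul_nonneg (by linarith) (by linarith)
  · rw [Set.disjoint_left]
    rintro ω ⟨h, _⟩ ⟨h', _⟩
    exact absurd h.2 (not_le.2 h'.1)

/-- Comparing conditional probabilities is comparing the probabilities of the intersections. -/
lemma cond_le_cond_iff [IsProbabilityMeasure P] {E A B : Set Ω} (hE : P E ≠ 0)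
    (hAm : NullMeasurableSet A P) (hBm : NullMeasurableSet B P) :
    P[|E] A ≤ P[|E] B ↔ P (E ∩ A) ≤ P (E ∩ B) := by
  have key {A : Set Ω} (hAm : NullMeasurableSet A P) : P[|E] A = (P E)⁻¹ * P (E ∩ A) := by
    rw [ProbabilityTheory.cond, Measure.smul_apply, smul_eq_mul, Measure.restrict_apply₀
      (hAm.mono_ac Measure.restrict_le_self.absolutelyContinuous), Set.inter_comm]
  rw [key hAm, key hBm]
  exact ENNReal.mul_le_mul_iff_right (ENNReal.inv_ne_zero.2 (measure_ne_top _ _))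
    (ENNReal.inv_ne_top.2 hE)

end Law

/-! ### Feedback and histories -/

open Classical in
lemma feedback_eq (r : Range) (x : Fin 2 → ℝ) :
    feedback r x =
      if x 0 ∈ Set.Ioc r.1 r.2 then
        if x 1 ∈ Set.Ioc r.1 r.2 then .collision else .success
      else if x 1 ∈ Set.Ioc r.1 r.2 then .success else .idle := by
  unfold feedback
  rw [Finset.card_filter, Fin.sum_univ_two]
  split_ifs <;> rfl

lemma feedback_eq_idle_iff {r : Range} {x : Fin 2 → ℝ} :
    feedback r x = .idle ↔ ∀ i, x i ∉ Set.Ioc r.1 r.2 := by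
  rw [feedback_eq, Fin.forall_fin_two]
  split_ifs <;> simp_all

lemma feedback_eq_collision_iff {r : Range} {x : Fin 2 → ℝ} :
    feedback r x = .collision ↔ ∀ i, x i ∈ Set.Ioc r.1 r.2 := by
  rw [feedback_eq, Fin.forall_fin_two]
  split_ifs <;> simp_all

lemma feedback_eq_success_iff {r : Range} {x : Fin 2 → ℝ} :
    feedback r x = .success ↔ (x 0 ∈ Set.Ioc r.1 r.2 ∧ x 1 ∉ Set.Ioc r.1 r.2) ∨
      (x 1 ∈ Set.Ioc r.1 r.2 ∧ x 0 ∉ Set.Ioc r.1 r.2) := by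
  rw [feedback_eq]
  split_ifs <;> simp_all

lemma measurableSet_feedback_eq (r : Range) (f : Feedback) :
    MeasurableSet {x : Fin 2 → ℝ | feedback r x = f} := by
  have h (i : Fin 2) : MeasurableSet {x : Fin 2 → ℝ | x i ∈ Set.Ioc r.1 r.2} :=
    measurable_pi_apply i measurableSet_Ioc
  cases f with
  | idle =>
    simp only [feedback_eq_idle_iff, Fin.forall_fin_two]
    exact (h 0).compl.inter (h 1).compl
  | success =>
    simp only [feedback_eq_success_iff]
    exact ((h 0).inter (h 1).compl).union ((h 1).inter (h 0).compl)
  | collision =>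
    simp only [feedback_eq_collision_iff, Fin.forall_fin_two]
    exact (h 0).inter (h 1)

@[simp] lemma length_history (σ : Strategy) (x : Fin 2 → ℝ) (n : ℕ) :
    (history σ x n).length = n := by
  induction n with
  | zero => rfl
  | succ n ih => simp [history, ih]

lemma history_succ_eq_append_iff {σ : Strategy} {x : Fin 2 → ℝ} {n : ℕ} {h : List Feedback}
    {f : Feedback} :
    history σ x (n + 1) = h ++ [f] ↔ history σ x n = h ∧ feedback (σ h) x = f := by
  rw [history, ← List.concat_eq_append, ← List.concat_eq_append, List.concat_inj]
  constructor
  · rintro ⟨rfl, h2⟩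
    exact ⟨rfl, h2⟩
  · rintro ⟨rfl, h2⟩
    exact ⟨rfl, h2⟩

lemma measurableSet_history_eq (σ : Strategy) (n : ℕ) (h : List Feedback) :
    MeasurableSet {x : Fin 2 → ℝ | history σ x n = h} := by
  induction n generalizing h with
  | zero => exact MeasurableSet.const ([] = h)
  | succ n ih =>
    rcases List.eq_nil_or_concat h with rfl | ⟨h, f, rfl⟩
    · simp [history]
    · simp only [List.concat_eq_append, history_succ_eq_append_iff]
      exact (ih h).inter (measurableSet_feedback_eq _ _)

lemma success_notMem_history_iff {σ : Strategy} {x : Fin 2 → ℝ} {n : ℕ} :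
    Feedback.success ∉ history σ x n ↔
      ∀ m < n, feedback (σ (history σ x m)) x ≠ .success := by
  induction n with
  | zero => simp [history]
  | succ n ih =>
    rw [history, List.mem_append, not_or, ih, List.mem_singleton, Nat.forall_lt_succ_right,
      eq_comm]

lemma FirstSuccess.success_notMem_history {σ : Strategy} {x : Fin 2 → ℝ} {n : ℕ}
    (h : FirstSuccess σ x n) : Feedback.success ∉ history σ x n :=
  success_notMem_history_iff.2 h.2

lemma exists_firstSuccess {σ : Strategy} {x : Fin 2 → ℝ} {n : ℕ}
    (h : Feedback.success ∈ history σ x n) : ∃ m, FirstSuccess σ x m := by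
  classical
  have hex : ∃ m, feedback (σ (history σ x m)) x = .success := by
    by_contra hne
    push Not at hne
    exact success_notMem_history_iff.2 (fun m _ => hne m) h
  exact ⟨Nat.find hex, Nat.find_spec hex, fun m hm => Nat.find_min hex hm⟩

open Classical in
/-- The feedback words of length `n` without a `success`. -/
def words : ℕ → Finset (List Feedback)
  | 0 => {[]}
  | n + 1 => (words n).image (· ++ [.idle]) ∪ (words n).image (· ++ [.collision])

lemma mem_words {n : ℕ} {h : List Feedback} :
    h ∈ words n ↔ h.length = n ∧ Feedback.success ∉ h := by
  induction n generalizing h with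
  | zero =>
    simp only [words, Finset.mem_singleton, List.length_eq_zero_iff]
    exact ⟨fun e => ⟨e, by simp [e]⟩, fun e => e.1⟩
  | succ n ih =>
    simp only [words, Finset.mem_union, Finset.mem_image, ih]
    constructor
    · rintro (⟨h', ⟨h1, h2⟩, rfl⟩ | ⟨h', ⟨h1, h2⟩, rfl⟩) <;> simp [h1, h2]
    · rintro ⟨h1, h2⟩
      rcases List.eq_nil_or_concat h with rfl | ⟨h, f, rfl⟩
      · simp at h1
      · simp only [List.concat_eq_append, List.length_append, List.length_singleton,
          Nat.add_right_cancel_iff, List.mem_append, List.mem_singleton, not_or] at h1 h2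
        cases f with
        | idle => exact .inl ⟨h, ⟨h1, h2.1⟩, by simp⟩
        | success => exact absurd rfl h2.2
        | collision => exact .inr ⟨h, ⟨h1, h2.1⟩, by simp⟩

lemma card_words_le (n : ℕ) : (words n).card ≤ 2 ^ n := by
  classical
  induction n with
  | zero => simp [words]
  | succ n ih =>
    refine (Finset.card_union_le _ _).trans ?_
    have h1 : ((words n).image (· ++ [Feedback.idle])).card ≤ _ := Finset.card_image_le
    have h2 : ((words n).image (· ++ [Feedback.collision])).card ≤ _ := Finset.card_image_le
    rw [pow_succ]
    exact (add_le_add (h1.trans ih) (h2.trans ih)).trans_eq (mul_two _).symm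

lemma measurableSet_success_notMem_history (σ : Strategy) (n : ℕ) :
    MeasurableSet {x : Fin 2 → ℝ | Feedback.success ∉ history σ x n} := by
  have : {x : Fin 2 → ℝ | Feedback.success ∉ history σ x n} =
      ⋃ h ∈ words n, {x | history σ x n = h} := by
    ext x
    simp [mem_words]
  rw [this]
  exact Finset.measurableSet_biUnion _ fun h _ => measurableSet_history_eq σ n h

/-! ### The delay as a sum of tail indicators -/

-- The minislot of index `n` is used exactly when the first `n` feedbacks contain no success. If
-- there never is one, every term is `1` and both sides are infinite.
open Classical in
lemma delay_eq_tsum (σ : Strategy) (x : Fin 2 → ℝ) :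
    delay σ x = ∑' n, if Feedback.success ∉ history σ x n then 1 else 0 := by
  by_cases hN : ∃ N, FirstSuccess σ x N
  · obtain ⟨N, hN⟩ := hN
    have hle (n : ℕ) : Feedback.success ∉ history σ x n ↔ n ∈ Finset.range (N + 1) := by
      rw [success_notMem_history_iff, Finset.mem_range, Nat.lt_succ_iff]
      exact ⟨fun h => not_lt.1 fun hlt => h N hlt hN.1, fun h m hm => hN.2 m (hm.trans_le h)⟩
    have hdelay : delay σ x = N + 1 := by
      refine le_antisymm (iInf₂_le N hN) (le_iInf₂ fun n hn => ?_)
      have : N ≤ n := not_lt.1 fun hlt => hN.2 n hlt hn.1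
      gcongr
    rw [hdelay, tsum_eq_sum (s := Finset.range (N + 1)) fun n hn => if_neg ((hle n).not.2 hn),
      Finset.sum_congr rfl fun n hn => if_pos ((hle n).2 hn)]
    simp
  · have hno (n : ℕ) : Feedback.success ∉ history σ x n := fun h => hN (exists_firstSuccess h)
    have hdelay : delay σ x = ⊤ := by
      simp only [delay, iInf_eq_top]
      exact fun n hn => absurd ⟨n, hn⟩ hN
    rw [hdelay, tsum_congr fun n => if_pos (hno n)]
    exact (ENNReal.tsum_const_eq_top_of_ne_zero one_ne_zero).symm

section Delay

variable {Ω : Type*} [MeasurableSpace Ω] {P : Measure Ω} {X : Fin 2 → Ω → ℝ}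

lemma expectedDelay_eq_tsum (hX : ∀ i, Measurable (X i)) (σ : Strategy) :
    expectedDelay P X σ =
      ∑' n, P {ω | Feedback.success ∉ history σ (fun i => X i ω) n} := by
  classical
  have hm (n : ℕ) : MeasurableSet {ω | Feedback.success ∉ history σ (fun i => X i ω) n} :=
    measurable_pi_lambda (fun ω i => X i ω) hX (measurableSet_success_notMem_history σ n)
  simp only [expectedDelay, delay_eq_tsum]
  rw [lintegral_tsum fun n => (Measurable.ite (hm n) measurable_const
    measurable_const).aemeasurable]
  refine tsum_congr fun n => ?_
  rw [← lintegral_indicator_one (hm n)]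
  refine lintegral_congr fun ω => ?_
  simp [Set.indicator]

lemma tsum_inv_two_pow : ∑' n : ℕ, ((2 : ℝ≥0∞) ^ n)⁻¹ = 2 := by
  simp_rw [ENNReal.inv_pow]
  rw [ENNReal.tsum_geometric, ENNReal.one_sub_inv_two, inv_inv]

/-! ### No strategy beats halving -/

/-- Idle and collision say the same thing about each user separately, and a pair of equal gains
tests exactly that. The case of `success` is vacuous, since equal gains never produce a lone
transmitter. -/
lemma feedback_const_eq_of_eq {r : Range} {x : Fin 2 → ℝ} {f : Feedback}
    (h : ∀ i, feedback r (fun _ => x i) = f) : feedback r x = f := by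
  cases f with
  | idle =>
    simp only [feedback_eq_idle_iff] at h ⊢
    exact fun i => h i i
  | success =>
    have := feedback_eq_success_iff.1 (h 0)
    tauto
  | collision =>
    simp only [feedback_eq_collision_iff] at h ⊢
    exact fun i => h i i

lemma history_eq_of_const {σ : Strategy} {x : Fin 2 → ℝ} {n : ℕ} {h : List Feedback}
    (hx : ∀ i, history σ (fun _ => x i) n = h) : history σ x n = h := by
  induction n generalizing h with
  | zero => exact hx 0
  | succ n ih =>
    rcases List.eq_nil_or_concat h with rfl | ⟨h, f, rfl⟩
    · exact absurd (hx 0) (by simp [history])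
    · simp only [List.concat_eq_append, history_succ_eq_append_iff] at hx ⊢
      exact ⟨ih fun i => (hx i).1, feedback_const_eq_of_eq fun i => (hx i).2⟩

lemma history_const_mem_words (σ : Strategy) (t : ℝ) (n : ℕ) :
    history σ (fun _ => t) n ∈ words n := by
  rw [mem_words, length_history, success_notMem_history_iff]
  refine ⟨rfl, fun m _ => ?_⟩
  rw [Ne, feedback_eq_success_iff]
  tauto

/-- The sets `A h` of gains `t` whose diagonal pair `(t,t)` has history `h`, for `h` in `words n`,
cover the line. If both gains lie in the same `A h`, the history is `h`, so the probability is at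
least the sum of the squares of at most `2^n` numbers `v h` with sum at least `1`. -/
lemma IsUniformPair.le_prob_success_notMem_history (hX : IsUniformPair P X) (σ : Strategy)
    (n : ℕ) :
    ((2 : ℝ≥0∞) ^ n)⁻¹ ≤ P {ω | Feedback.success ∉ history σ (fun i => X i ω) n} := by
  set A : List Feedback → Set ℝ := fun h => {t | history σ (fun _ => t) n = h} with hA
  have hAm (h : List Feedback) : MeasurableSet (A h) :=
    measurable_pi_lambda (fun (t : ℝ) (_ : Fin 2) => t) (fun _ => measurable_id)
      (measurableSet_history_eq σ n h)
  set v : List Feedback → ℝ := fun h => (volume (A h ∩ Set.Icc 0 1)).toReal with hv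
  have hfin (h : List Feedback) : volume (A h ∩ Set.Icc 0 1) ≠ ⊤ :=
    ne_top_of_le_ne_top (by simp) (measure_mono (Set.inter_subset_right (s := A h)
      (t := Set.Icc (0 : ℝ) 1)))
  have hsum : 1 ≤ ∑ h ∈ words n, v h := by
    have h1 : Set.Icc (0 : ℝ) 1 ⊆ ⋃ h ∈ words n, A h ∩ Set.Icc 0 1 := fun t ht =>
      Set.mem_iUnion₂.2 ⟨_, history_const_mem_words σ t n, rfl, ht⟩
    have h2 := (measure_mono h1).trans (measure_biUnion_finset_le (μ := volume) _ _)
    rw [Real.volume_Icc, sub_zero, ENNReal.ofReal_one] at h2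
    rw [← ENNReal.toReal_sum fun h _ => hfin h, ← ENNReal.toReal_one]
    exact ENNReal.toReal_mono (ENNReal.sum_ne_top.2 fun h _ => hfin h) h2
  have hcs : 1 ≤ (2 : ℝ) ^ n * ∑ h ∈ words n, v h ^ 2 := by
    have h1 := sq_sum_le_card_mul_sum_sq (s := words n) (f := v)
    have h2 : ((words n).card : ℝ) ≤ 2 ^ n := by exact_mod_cast card_words_le n
    have h3 : 0 ≤ ∑ h ∈ words n, v h ^ 2 := Finset.sum_nonneg fun h _ => sq_nonneg _
    have h4 : 1 ≤ (∑ h ∈ words n, v h) ^ 2 := one_le_pow₀ hsum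
    exact h4.trans (h1.trans (mul_le_mul_of_nonneg_right h2 h3))
  have hprob (h : List Feedback) :
      P {ω | X 0 ω ∈ A h ∧ X 1 ω ∈ A h} = ENNReal.ofReal (v h ^ 2) := by
    rw [hX.prob_mem_mem (hAm h) (hAm h), sq, ENNReal.ofReal_mul ENNReal.toReal_nonneg,
      ENNReal.ofReal_toReal (hfin h)]
  have hsub : (⋃ h ∈ words n, {ω | X 0 ω ∈ A h ∧ X 1 ω ∈ A h}) ⊆
      {ω | Feedback.success ∉ history σ (fun i => X i ω) n} := by
    refine Set.iUnion₂_subset fun h hh ω hω => ?_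
    have : history σ (fun i => X i ω) n = h :=
      history_eq_of_const (Fin.forall_fin_two.2 ⟨hω.1, hω.2⟩)
    simp only [Set.mem_ofPred_eq, this]
    exact (mem_words.1 hh).2
  refine le_trans ?_ (measure_mono hsub)
  rw [measure_biUnion_finset, Finset.sum_congr rfl fun h _ => hprob h,
    ← ENNReal.ofReal_sum_of_nonneg fun h _ => sq_nonneg _]
  · have e : ((2 : ℝ≥0∞) ^ n)⁻¹ = ENNReal.ofReal (((2 : ℝ) ^ n)⁻¹) := by
      rw [ENNReal.ofReal_inv_of_pos (by positivity), ENNReal.ofReal_pow (by norm_num)]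
      norm_num
    rw [e]
    refine ENNReal.ofReal_le_ofReal ?_
    rw [inv_le_iff_one_le_mul₀' (by positivity)]
    exact hcs
  · intro h _ h' _ hne
    refine Set.disjoint_left.2 fun ω h1 h2 => hne ?_
    exact (show history σ (fun _ => X 0 ω) n = h from h1.1).symm.trans h2.1
  · exact fun h _ => (hX.measurable 0 (hAm h)).inter (hX.measurable 1 (hAm h))

theorem IsUniformPair.two_le_expectedDelay (hX : IsUniformPair P X) (σ : Strategy) :
    2 ≤ expectedDelay P X σ := by
  rw [expectedDelay_eq_tsum hX.measurable, ← tsum_inv_two_pow]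
  exact ENNReal.tsum_le_tsum fun n => hX.le_prob_success_notMem_history σ n

end Delay

/-! ### Bisecting strategies -/

/-- The half of the interval `q` singled out by a feedback. -/
def halve (q : ℝ × ℝ) : Feedback → ℝ × ℝ
  | .idle => (q.1, (q.1 + q.2) / 2)
  | .success => q
  | .collision => ((q.1 + q.2) / 2, q.2)

/-- The endpoints of the interval that contains both gains after the history `h` of a bisecting
strategy. -/
def bisectInterval (h : List Feedback) : ℝ × ℝ := h.foldl halve (0, 1)

@[simp] lemma bisectInterval_append (h : List Feedback) (f : Feedback) :
    bisectInterval (h ++ [f]) = halve (bisectInterval h) f := by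
  simp [bisectInterval]

/-- After the history `h`, the strategy probes the upper half of the remaining interval. -/
def Bisects (σ : Strategy) (h : List Feedback) : Prop :=
  (σ h).1 = ((bisectInterval h).1 + (bisectInterval h).2) / 2 ∧ (bisectInterval h).2 ≤ (σ h).2

lemma exists_bisectInterval_eq {h : List Feedback} (hs : Feedback.success ∉ h) :
    ∃ i : ℕ, i < 2 ^ h.length ∧
      bisectInterval h = ((i : ℝ) / 2 ^ h.length, ((i : ℝ) + 1) / 2 ^ h.length) := by
  induction h using List.reverseRecOn with
  | nil => exact ⟨0, by simp, by simp [bisectInterval]⟩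
  | append_singleton h f ih =>
    rw [List.mem_append, not_or] at hs
    obtain ⟨i, hi, e⟩ := ih hs.1
    simp only [bisectInterval_append, e, List.length_append, List.length_singleton, pow_succ]
    cases f with
    | idle =>
      refine ⟨2 * i, by omega, ?_⟩
      simp only [halve, Prod.mk.injEq]
      push_cast
      constructor <;> field_simp
      ring
    | success => exact absurd (List.mem_singleton_self _) hs.2
    | collision =>
      refine ⟨2 * i + 1, by omega, ?_⟩
      simp only [halve, Prod.mk.injEq]
      push_cast
      constructor <;> field_simp <;> ring

lemma bisectInterval_snd_sub_fst {h : List Feedback} (hs : Feedback.success ∉ h) :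
    (bisectInterval h).2 - (bisectInterval h).1 = ((2 : ℝ) ^ h.length)⁻¹ := by
  obtain ⟨i, -, e⟩ := exists_bisectInterval_eq hs
  rw [e]; field_simp; ring

lemma bisectInterval_lt {h : List Feedback} (hs : Feedback.success ∉ h) :
    (bisectInterval h).1 < (bisectInterval h).2 := by
  have := bisectInterval_snd_sub_fst hs
  have h2 : 0 < ((2 : ℝ) ^ h.length)⁻¹ := by positivity
  linarith

lemma bisectInterval_fst_nonneg {h : List Feedback} (hs : Feedback.success ∉ h) :
    0 ≤ (bisectInterval h).1 := by
  obtain ⟨i, -, e⟩ := exists_bisectInterval_eq hs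
  rw [e]; positivity

lemma bisectInterval_snd_le_one {h : List Feedback} (hs : Feedback.success ∉ h) :
    (bisectInterval h).2 ≤ 1 := by
  obtain ⟨i, hi, e⟩ := exists_bisectInterval_eq hs
  rw [e]
  refine div_le_one_of_le₀ ?_ (by positivity)
  exact_mod_cast hi

/-- No gain exceeds the upper end of the current interval, so a range reaching beyond it acts like
the upper half. Bisection is required only at shorter histories because `isMPAStrategy_iff` uses
this lemma before anything is known about the choice at `h`. -/
lemma history_eq_iff_mem_bisectInterval {σ : Strategy} {x : Fin 2 → ℝ}
    (hx : ∀ i, x i ∈ Set.Ioc (0 : ℝ) 1) {h : List Feedback} (hs : Feedback.success ∉ h)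
    (hσ : ∀ h', Feedback.success ∉ h' → h'.length < h.length → Bisects σ h') :
    history σ x h.length = h ↔
      ∀ i, x i ∈ Set.Ioc (bisectInterval h).1 (bisectInterval h).2 := by
  induction h using List.reverseRecOn with
  | nil => simpa [history, bisectInterval] using hx
  | append_singleton h f ih =>
    rw [List.mem_append, not_or] at hs
    simp only [List.length_append, List.length_singleton] at hσ ⊢
    have hlt := bisectInterval_lt hs.1
    obtain ⟨hmid, htop⟩ := hσ h hs.1 (Nat.lt_succ_self _)
    rw [history_succ_eq_append_iff, ih hs.1 fun h' h1 h2 => hσ h' h1 (h2.trans (Nat.lt_succ_self _)),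
      bisectInterval_append]
    set l := (bisectInterval h).1
    set u := (bisectInterval h).2
    cases f with
    | idle =>
      rw [feedback_eq_idle_iff, ← forall_and]
      refine forall_congr' fun i => ?_
      simp only [halve, Set.mem_Ioc, hmid, not_and_or, not_lt, not_le]
      constructor
      · rintro ⟨⟨h1, h2⟩, h3 | h3⟩
        · exact ⟨h1, h3⟩
        · linarith
      · rintro ⟨h1, h2⟩
        exact ⟨⟨h1, by linarith⟩, .inl h2⟩
    | success => exact absurd (List.mem_singleton_self _) hs.2
    | collision =>
      rw [feedback_eq_collision_iff, ← forall_and]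
      refine forall_congr' fun i => ?_
      simp only [halve, Set.mem_Ioc, hmid]
      constructor
      · rintro ⟨⟨h1, h2⟩, h3, h4⟩
        exact ⟨h3, h2⟩
      · rintro ⟨h1, h2⟩
        exact ⟨⟨by linarith, h2⟩, h1, by linarith⟩

/-- A strategy that bisects after every unresolved history. -/
def IsBisecting (σ : Strategy) : Prop := ∀ h, Feedback.success ∉ h → Bisects σ h

lemma IsBisecting.mem_bisectInterval {σ : Strategy} (hσ : IsBisecting σ) {x : Fin 2 → ℝ}
    (hx : ∀ i, x i ∈ Set.Ioc (0 : ℝ) 1) {n : ℕ} (hs : Feedback.success ∉ history σ x n) (i : Fin 2) :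
    x i ∈ Set.Ioc (bisectInterval (history σ x n)).1 (bisectInterval (history σ x n)).2 :=
  (history_eq_iff_mem_bisectInterval hx hs fun h' h1 _ => hσ h' h1).1 (by rw [length_history]) i

lemma IsBisecting.exists_firstSuccess {σ : Strategy} (hσ : IsBisecting σ) {x : Fin 2 → ℝ}
    (hx : ∀ i, x i ∈ Set.Ioc (0 : ℝ) 1) (hne : x 0 ≠ x 1) : ∃ n, FirstSuccess σ x n := by
  by_contra hno
  have hs (n : ℕ) : Feedback.success ∉ history σ x n := fun h =>
    hno (Contention.exists_firstSuccess h)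
  obtain ⟨n, hn⟩ := exists_pow_lt_of_lt_one (abs_pos.2 (sub_ne_zero.2 hne))
    (show (2⁻¹ : ℝ) < 1 by norm_num)
  have h0 := hσ.mem_bisectInterval hx (hs n) 0
  have h1 := hσ.mem_bisectInterval hx (hs n) 1
  have hlen := bisectInterval_snd_sub_fst (hs n)
  rw [length_history, ← inv_pow] at hlen
  have : |x 0 - x 1| ≤ 2⁻¹ ^ n := by
    rw [← hlen, abs_le]
    constructor <;> linarith [h0.1, h0.2, h1.1, h1.2]
  linarith

lemma identifiesBest_iff {r : Range} {x : Fin 2 → ℝ} :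
    IdentifiesBest r x ↔ (x 0 ∈ Set.Ioc r.1 r.2 ∧ x 1 ≤ r.1) ∨
      (x 1 ∈ Set.Ioc r.1 r.2 ∧ x 0 ≤ r.1) := by
  have key {a b : ℝ} (ha : a ∈ Set.Ioc r.1 r.2) : (b ∉ Set.Ioc r.1 r.2 ∧ b < a) ↔ b ≤ r.1 := by
    constructor
    · rintro ⟨h1, h2⟩
      exact not_lt.1 fun h => h1 ⟨h, h2.le.trans ha.2⟩
    · exact fun h => ⟨fun h1 => h.not_gt h1.1, h.trans_lt ha.1⟩
  simp only [IdentifiesBest, Fin.exists_fin_two, Fin.forall_fin_two, ne_eq, not_true_eq_false,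
    IsEmpty.forall_iff, true_and, and_true, one_ne_zero, zero_ne_one, not_false_eq_true,
    forall_const]
  exact or_congr (and_congr_right fun h => key h) (and_congr_right fun h => key h)

/-- Neither gain exceeds the top of the range, so the silent user can only lie at or below its lower
end. -/
lemma IsBisecting.identifiesBest_and_separates {σ : Strategy} (hσ : IsBisecting σ) {x : Fin 2 → ℝ}
    (hx : ∀ i, x i ∈ Set.Ioc (0 : ℝ) 1) {n : ℕ} (hn : FirstSuccess σ x n) :
    IdentifiesBest (σ (history σ x n)) x ∧ Separates (σ (history σ x n)).1 (ordered x) := by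
  have hs := hn.success_notMem_history
  obtain ⟨-, htop⟩ := hσ _ hs
  have h0 := (hσ.mem_bisectInterval hx hs 0).2.trans htop
  have h1 := (hσ.mem_bisectInterval hx hs 1).2.trans htop
  rw [identifiesBest_iff]
  rcases feedback_eq_success_iff.1 hn.1 with ⟨h2, h3⟩ | ⟨h2, h3⟩
  · have h4 : x 1 ≤ (σ (history σ x n)).1 := not_lt.1 fun h => h3 ⟨h, h1⟩
    exact ⟨.inl ⟨h2, h4⟩, (min_le_right _ _).trans h4, h2.1.trans_le (le_max_left _ _)⟩
  · have h4 : x 0 ≤ (σ (history σ x n)).1 := not_lt.1 fun h => h3 ⟨h, h0⟩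
    exact ⟨.inr ⟨h2, h4⟩, (min_le_left _ _).trans h4, h2.1.trans_le (le_max_right _ _)⟩

lemma isBisecting_osa_two : IsBisecting (osa 2) := by
  intro h hs
  have key : h.foldl (osaStep 2) ⟨0, 1 - 1 / (2 : ℕ), 1⟩ =
      ⟨(bisectInterval h).1, ((bisectInterval h).1 + (bisectInterval h).2) / 2,
        (bisectInterval h).2⟩ := by
    induction h using List.reverseRecOn with
    | nil => norm_num [bisectInterval]
    | append_singleton h f ih =>
      rw [List.mem_append, not_or] at hs
      rw [List.foldl_append, ih hs.1, bisectInterval_append]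
      cases f with
      | idle =>
        simp only [List.foldl_cons, List.foldl_nil, osaStep, halve]
        split_ifs with h0
        · rfl
        -- When `low = 0` the idle rule multiplies `min` by `1 - 1/N`; for two users this is again
        -- the midpoint of `low` and `min`.
        · rw [not_not] at h0
          simp only [h0, OSAState.mk.injEq]
          norm_num
          ring
      | success => exact absurd (List.mem_singleton_self _) hs.2
      | collision => rfl
  simp only [Bisects, osa, key, le_refl, and_self]

/-! ### Maximal probability allocation is bisection -/

section MPA

variable {Ω : Type*} [MeasurableSpace Ω] {P : Measure Ω} {X : Fin 2 → Ω → ℝ}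

omit [MeasurableSpace Ω] in
lemma split_eq_empty_of_lt {l t u : ℝ} (h : t ≤ l ∨ u ≤ t) : split X l t u = ∅ := by
  rw [Set.eq_empty_iff_forall_notMem]
  rintro ω (⟨h1, h2⟩ | ⟨h1, h2⟩) <;> rcases h with h | h <;>
    linarith [h1.1, h1.2, h2.1, h2.2]

lemma IsUniformPair.prob_split_midpoint (hX : IsUniformPair P X) {l u : ℝ} (hl : 0 ≤ l)
    (hlu : l < u) (hu : u ≤ 1) :
    P (split X l ((l + u) / 2) u) = ENNReal.ofReal ((u - l) ^ 2 / 2) := by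
  rw [hX.prob_split hl (by linarith) (by linarith) hu]
  congr 1; ring

lemma IsUniformPair.prob_split_le (hX : IsUniformPair P X) {l t v u : ℝ} (hl : 0 ≤ l)
    (hu : u ≤ 1) (hv : v ≤ u) :
    P (split X l t v) ≤ ENNReal.ofReal ((u - l) ^ 2 / 2) := by
  by_cases h : t ≤ l ∨ v ≤ t
  · simp [split_eq_empty_of_lt h]
  push Not at h
  rw [hX.prob_split hl h.1.le h.2.le (hv.trans hu)]
  refine ENNReal.ofReal_le_ofReal ?_
  nlinarith [sq_nonneg (t - l - (u - t)), mul_nonneg (sub_nonneg.2 h.1.le) (sub_nonneg.2 hv)]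

/-- For `l < t < v` the deficit `(u-l)²/2 - 2(t-l)(v-t)` equals `2(t-(l+u)/2)² + 2(t-l)(u-v)`, a sum
of two nonnegative terms; both must vanish. -/
lemma IsUniformPair.eq_midpoint_of_le_prob_split (hX : IsUniformPair P X) {l t v u : ℝ}
    (hl : 0 ≤ l) (hlu : l < u) (hu : u ≤ 1) (hv : v ≤ u)
    (hle : ENNReal.ofReal ((u - l) ^ 2 / 2) ≤ P (split X l t v)) :
    t = (l + u) / 2 ∧ v = u := by
  have hpos : 0 < (u - l) ^ 2 / 2 := by
    have := pow_pos (sub_pos.2 hlu) 2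
    linarith
  by_cases h : t ≤ l ∨ v ≤ t
  · rw [split_eq_empty_of_lt h, measure_empty, nonpos_iff_eq_zero, ENNReal.ofReal_eq_zero] at hle
    linarith
  push Not at h
  rw [hX.prob_split hl h.1.le h.2.le (hv.trans hu), ENNReal.ofReal_le_ofReal_iff] at hle
  · have h1 : 0 ≤ (t - l) * (u - v) := mul_nonneg (by linarith [h.1]) (by linarith)
    have h2 : (t - (l + u) / 2) ^ 2 ≤ 0 := by nlinarith
    have h3 : t - (l + u) / 2 = 0 := pow_eq_zero_iff (two_ne_zero) |>.1
      (le_antisymm h2 (sq_nonneg _))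
    have h4 : (t - l) * (u - v) ≤ 0 := by nlinarith [sq_nonneg (t - (l + u) / 2)]
    refine ⟨by linarith, ?_⟩
    have h5 := le_antisymm h4 h1
    rcases mul_eq_zero.1 h5 with h6 | h6 <;> linarith [h.1]
  · exact mul_nonneg zero_le_two (mul_nonneg (by linarith [h.1]) (by linarith [h.2]))

omit [MeasurableSpace Ω] in
lemma box_inter_identifiesBest (l u : ℝ) (r : Range) :
    box X l u ∩ {ω | IdentifiesBest r fun i => X i ω} = split X l r.1 (min r.2 u) := by
  ext ω
  simp only [box, split, identifiesBest_iff, Fin.forall_fin_two, Set.mem_inter_iff,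
    Set.mem_ofPred_eq, Set.mem_Ioc, Set.mem_union, le_min_iff]
  constructor
  · rintro ⟨⟨⟨_, _⟩, _, _⟩, ⟨⟨_, _⟩, _⟩ | ⟨⟨_, _⟩, _⟩⟩
    · exact .inr (by tauto)
    · exact .inl (by tauto)
  · rintro (⟨⟨h1, h2⟩, h3, h4, h5⟩ | ⟨⟨h3, h4, h5⟩, h1, h2⟩)
    · exact ⟨⟨⟨h1, by linarith⟩, by linarith, h5⟩, .inr ⟨⟨h3, h4⟩, h2⟩⟩
    · exact ⟨⟨⟨by linarith, h5⟩, h1, by linarith⟩, .inl ⟨⟨h3, h4⟩, h2⟩⟩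

lemma measurableSet_identifiesBest (hX : ∀ i, Measurable (X i)) (r : Range) :
    MeasurableSet {ω | IdentifiesBest r fun i => X i ω} := by
  simp only [identifiesBest_iff]
  exact ((hX 0 measurableSet_Ioc).inter (hX 1 measurableSet_Iic)).union
    ((hX 1 measurableSet_Ioc).inter (hX 0 measurableSet_Iic))

lemma cond_congr_ae {E F : Set Ω} (h : E =ᵐ[P] F) : P[|E] = P[|F] := by
  simp only [ProbabilityTheory.cond, measure_congr h, Measure.restrict_congr_set h]

variable [IsProbabilityMeasure P] (hX : IsUniformPair P X)
include hX

omit [IsProbabilityMeasure P] in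
lemma IsUniformPair.history_eq_ae {σ : Strategy} {h : List Feedback}
    (hs : Feedback.success ∉ h)
    (hσ : ∀ h', Feedback.success ∉ h' → h'.length < h.length → Bisects σ h') :
    {ω | history σ (fun i => X i ω) h.length = h} =ᵐ[P]
      box X (bisectInterval h).1 (bisectInterval h).2 := by
  filter_upwards [hX.ae_mem_Ioc] with ω hω
  exact propext (history_eq_iff_mem_bisectInterval hω hs hσ)

/-- Given that both gains lie in `(l, u]`, the ranges that are most likely to identify the best
user are those that probe the upper half. -/
lemma IsUniformPair.forall_cond_box_le_iff {l u : ℝ} (hl : 0 ≤ l) (hlu : l < u) (hu : u ≤ 1)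
    (s : Range) :
    (∀ r : Range, P[|box X l u] {ω | IdentifiesBest r fun i => X i ω} ≤
      P[|box X l u] {ω | IdentifiesBest s fun i => X i ω}) ↔ s.1 = (l + u) / 2 ∧ u ≤ s.2 := by
  have hbox : P (box X l u) ≠ 0 := by
    rw [hX.prob_box hl hlu.le hu]
    exact (ENNReal.ofReal_pos.2 (pow_pos (by linarith) 2)).ne'
  have hm (r : Range) := (measurableSet_identifiesBest hX.measurable r).nullMeasurableSet (μ := P)
  simp only [fun r => cond_le_cond_iff hbox (hm r) (hm s), box_inter_identifiesBest]
  constructor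
  · intro h
    have h1 := h ((l + u) / 2, u)
    simp only [min_self] at h1
    rw [hX.prob_split_midpoint hl hlu hu] at h1
    obtain ⟨h2, h3⟩ := hX.eq_midpoint_of_le_prob_split hl hlu hu (min_le_right _ _) h1
    exact ⟨h2, min_eq_right_iff.1 h3⟩
  · rintro ⟨h1, h2⟩ r
    rw [h1, min_eq_right h2, hX.prob_split_midpoint hl hlu hu]
    exact hX.prob_split_le hl hu (min_le_right _ _)

/-- The event of a history `h` depends only on the choices at shorter histories. By strong induction
on length these bisect, so the event is almost surely a box. The box has positive probability, hence
the conditional probability is not degenerate and its maximizers are the bisecting ranges. -/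
theorem IsUniformPair.isMPAStrategy_iff {σ : Strategy} :
    IsMPAStrategy P X σ ↔ IsBisecting σ := by
  have key {h : List Feedback} (hs : Feedback.success ∉ h)
      (hσ : ∀ h', Feedback.success ∉ h' → h'.length < h.length → Bisects σ h') :
      (∀ r : Range, P[|{ω | history σ (fun i => X i ω) h.length = h}]
          {ω | IdentifiesBest r (fun i => X i ω)} ≤
        P[|{ω | history σ (fun i => X i ω) h.length = h}]
          {ω | IdentifiesBest (σ h) (fun i => X i ω)}) ↔ Bisects σ h := by
    rw [cond_congr_ae (hX.history_eq_ae hs hσ)]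
    exact hX.forall_cond_box_le_iff (bisectInterval_fst_nonneg hs) (bisectInterval_lt hs)
      (bisectInterval_snd_le_one hs) (σ h)
  constructor
  · intro hM
    have (n : ℕ) : ∀ h : List Feedback, h.length = n → Feedback.success ∉ h → Bisects σ h := by
      induction n using Nat.strong_induction_on with
      | _ n ih =>
        rintro h rfl hs
        exact (key hs fun h' hs' hlt => ih _ hlt h' rfl hs').1 (hM h hs)
    exact fun h hs => this _ h rfl hs
  · exact fun hB h hs => (key hs fun h' hs' _ => hB h' hs').2 (hB h hs)

-- At most `2^n` words avoid a success, and each has probability `4^(-n)`, the area of its box. The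
-- tail is thus at most `2^(-n)`, matching the lower bound for arbitrary strategies.
omit [IsProbabilityMeasure P] in
theorem IsUniformPair.expectedDelay_eq_two {σ : Strategy} (hσ : IsBisecting σ) :
    expectedDelay P X σ = 2 := by
  refine le_antisymm ?_ (hX.two_le_expectedDelay σ)
  rw [expectedDelay_eq_tsum hX.measurable, ← tsum_inv_two_pow]
  refine ENNReal.tsum_le_tsum fun n => ?_
  have hsub : {ω | Feedback.success ∉ history σ (fun i => X i ω) n} ⊆
      ⋃ h ∈ words n, {ω | history σ (fun i => X i ω) n = h} := fun ω hω =>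
    Set.mem_iUnion₂.2 ⟨_, mem_words.2 ⟨length_history _ _ _, hω⟩, rfl⟩
  have hword (h : List Feedback) (hh : h ∈ words n) :
      P {ω | history σ (fun i => X i ω) n = h} = ((2 : ℝ≥0∞) ^ n)⁻¹ * ((2 : ℝ≥0∞) ^ n)⁻¹ := by
    obtain ⟨rfl, hs⟩ := mem_words.1 hh
    rw [measure_congr (hX.history_eq_ae hs fun h' hs' _ => hσ h' hs'),
      hX.prob_box (bisectInterval_fst_nonneg hs) (bisectInterval_lt hs).le
      (bisectInterval_snd_le_one hs), bisectInterval_snd_sub_fst hs, sq,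
      ENNReal.ofReal_mul (by positivity), ENNReal.ofReal_inv_of_pos (by positivity),
      ENNReal.ofReal_pow (by norm_num)]
    norm_num
  calc P {ω | Feedback.success ∉ history σ (fun i => X i ω) n}
      ≤ ∑ h ∈ words n, P {ω | history σ (fun i => X i ω) n = h} :=
        (measure_mono hsub).trans (measure_biUnion_finset_le _ _)
    _ = (words n).card * (((2 : ℝ≥0∞) ^ n)⁻¹ * ((2 : ℝ≥0∞) ^ n)⁻¹) := by
        rw [Finset.sum_congr rfl hword, Finset.sum_const, nsmul_eq_mul]
    _ ≤ (2 : ℝ≥0∞) ^ n * (((2 : ℝ≥0∞) ^ n)⁻¹ * ((2 : ℝ≥0∞) ^ n)⁻¹) := by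
        gcongr
        exact_mod_cast card_words_le n
    _ = ((2 : ℝ≥0∞) ^ n)⁻¹ := by
        rw [← mul_assoc, ENNReal.mul_inv_cancel (by simp) (by simp), one_mul]

end MPA

/-! ### The entropy inequality behind a single threshold -/

/-- The difference `f` of the two sides vanishes at `0` and `1/2`, and `f'' = 8 log 2 - 1/(x(1-x))`
changes sign once on `(0,1/2)`, at the point `s` below. On `[s,1-s]`, `f` is convex and symmetric
about `1/2`, so its minimum is `f (1/2) = 0`. On `[0,s]` it is concave with nonnegative end values.
-/
lemma four_mul_log_two_le_binEntropy {t : ℝ} (ht0 : 0 ≤ t) (ht1 : t ≤ 1) :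
    4 * Real.log 2 * (t * (1 - t)) ≤ Real.binEntropy t := by
  wlog hhalf : t ≤ 1 / 2 generalizing t
  · have := this (t := 1 - t) (by linarith) (by linarith) (by linarith)
    rw [Real.binEntropy_one_sub] at this
    linarith
  set q : ℝ → ℝ := fun t => 4 * Real.log 2 * (t * (1 - t)) with hq
  set f : ℝ → ℝ := fun t => Real.binEntropy t - q t with hf
  have hlog := Real.log_two_gt_d9
  have hqd (x : ℝ) : HasDerivAt q (4 * Real.log 2 * (1 - 2 * x)) x := by
    have := (((hasDerivAt_id x).mul ((hasDerivAt_id x).const_sub 1)).const_mul (4 * Real.log 2))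
    refine this.congr_deriv ?_
    simp only [id]; ring
  have hfd {x : ℝ} (h0 : 0 < x) (h1 : x < 1) :
      HasDerivAt f (Real.log (1 - x) - Real.log x - 4 * Real.log 2 * (1 - 2 * x)) x :=
    (Real.hasDerivAt_binEntropy h0.ne' h1.ne).sub (hqd x)
  have hfd2 {x : ℝ} (h0 : 0 < x) (h1 : x < 1) :
      HasDerivAt (deriv f) (-1 / (x * (1 - x)) + 8 * Real.log 2) x := by
    have h1x : 1 - x ≠ 0 := by linarith
    have e : deriv f =ᶠ[nhds x]
        fun x => Real.log (1 - x) - Real.log x - 4 * Real.log 2 * (1 - 2 * x) := by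
      filter_upwards [Ioo_mem_nhds h0 h1] with y hy using (hfd hy.1 hy.2).deriv
    have d := ((((hasDerivAt_id x).const_sub 1).log h1x).sub (Real.hasDerivAt_log h0.ne')).sub
      ((((hasDerivAt_id x).const_mul 2).const_sub 1).const_mul (4 * Real.log 2))
    refine (d.congr_of_eventuallyEq e).congr_deriv ?_
    simp only [id]
    field_simp
    ring
  have hcont : Continuous f := by
    have : Continuous q := by fun_prop
    exact Real.binEntropy_continuous.sub this
  obtain ⟨s, ⟨hs0, hs1⟩, hs⟩ : ∃ s ∈ Set.Icc (0 : ℝ) (1 / 2), 8 * Real.log 2 * (s * (1 - s)) = 1 := by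
    refine intermediate_value_Icc (f := fun s : ℝ => 8 * Real.log 2 * (s * (1 - s)))
      (by norm_num) (by fun_prop) ⟨by norm_num, by norm_num; linarith⟩
  have hs0' : 0 < s := by
    rcases hs0.eq_or_lt with rfl | h
    · norm_num at hs
    · exact h
  have hmid : f (1 / 2) = 0 := by
    have : (1 / 2 : ℝ) = 2⁻¹ := by norm_num
    simp only [hf, hq, this, Real.binEntropy_two_inv]; ring
  have hsymm (x : ℝ) : f (1 - x) = f x := by
    simp only [hf, hq, Real.binEntropy_one_sub]; ring
  have hconv : ConvexOn ℝ (Set.Icc s (1 - s)) f := by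
    refine convexOn_of_deriv2_nonneg (convex_Icc _ _) hcont.continuousOn ?_ ?_ ?_ <;>
      rw [interior_Icc] <;> intro x hx
    · exact (hfd (hs0'.trans hx.1) (by linarith [hx.2])).differentiableAt.differentiableWithinAt
    · exact (hfd2 (hs0'.trans hx.1) (by linarith [hx.2])).differentiableAt.differentiableWithinAt
    · have h0 : 0 < x := hs0'.trans hx.1
      have h1 : 0 < 1 - x := by linarith [hx.2]
      rw [Function.iterate_succ, Function.iterate_one, Function.comp,
        (hfd2 h0 (by linarith)).deriv]
      have : 1 / (x * (1 - x)) ≤ 8 * Real.log 2 := by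
        rw [div_le_iff₀ (by positivity)]
        refine hs.ge.trans ?_
        have : s * (1 - s) ≤ x * (1 - x) := by nlinarith [hx.1, hx.2]
        exact mul_le_mul_of_nonneg_left this (by positivity)
      have e : -1 / (x * (1 - x)) = -(1 / (x * (1 - x))) := by ring
      rw [e]; linarith
  have hconc : ConcaveOn ℝ (Set.Icc 0 s) f := by
    refine concaveOn_of_deriv2_nonpos (convex_Icc _ _) hcont.continuousOn ?_ ?_ ?_ <;>
      rw [interior_Icc] <;> intro x hx
    · exact (hfd hx.1 (by linarith [hx.2])).differentiableAt.differentiableWithinAt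
    · exact (hfd2 hx.1 (by linarith [hx.2])).differentiableAt.differentiableWithinAt
    · have h0 : 0 < x := hx.1
      have h1 : 0 < 1 - x := by linarith [hx.2]
      rw [Function.iterate_succ, Function.iterate_one, Function.comp,
        (hfd2 h0 (by linarith)).deriv]
      have : 8 * Real.log 2 ≤ 1 / (x * (1 - x)) := by
        rw [le_div_iff₀ (by positivity)]
        refine le_trans ?_ hs.le
        have : x * (1 - x) ≤ s * (1 - s) := by nlinarith [hx.1, hx.2]
        exact mul_le_mul_of_nonneg_left this (by positivity)
      have e : -1 / (x * (1 - x)) = -(1 / (x * (1 - x))) := by ring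
      rw [e]; linarith
  have hright : ∀ x, s ≤ x → x ≤ 1 / 2 → 0 ≤ f x := by
    intro x hx hx'
    have := hconv.2 (show x ∈ Set.Icc s (1 - s) from ⟨hx, by linarith⟩)
      (show 1 - x ∈ Set.Icc s (1 - s) from ⟨by linarith, by linarith⟩)
      (show (0 : ℝ) ≤ 1 / 2 by norm_num) (show (0 : ℝ) ≤ 1 / 2 by norm_num) (by norm_num)
    simp only [smul_eq_mul, hsymm] at this
    rw [show 1 / 2 * x + 1 / 2 * (1 - x) = 1 / 2 by ring, hmid] at this
    linarith
  suffices 0 ≤ f t by simp only [hf, hq] at this; linarith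
  rcases le_total s t with h | h
  · exact hright t h hhalf
  · have := hconc.2 (show (0 : ℝ) ∈ Set.Icc 0 s from ⟨le_rfl, hs0⟩)
      (show s ∈ Set.Icc 0 s from ⟨hs0, le_rfl⟩)
      (show 0 ≤ 1 - t / s by rw [sub_nonneg, div_le_one hs0']; exact h)
      (show 0 ≤ t / s by positivity) (by ring)
    have e0 : f 0 = 0 := by simp [hf, hq]
    simp only [smul_eq_mul, mul_zero, zero_add, e0, div_mul_cancel₀ _ hs0'.ne'] at this
    exact (mul_nonneg (by positivity) (hright s le_rfl hs1)).trans this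

/-- The entropy budget of an interval of length `a + b` carrying threshold mass `m` is at most what
is spent when a threshold of mass `p` splits off sub-intervals of lengths `a` and `b`. -/
lemma split_budget {a b p ma mb m : ℝ} (ha : 0 < a) (hb : 0 < b) (hp : 0 < p) (hma : 0 < ma)
    (hmb : 0 < mb) (hm : p + ma + mb ≤ m) :
    (a + b) ^ 2 * (3 - Real.logb 2 m) ≤ 2 * (a * b) * (-Real.logb 2 p) +
      a ^ 2 * (3 - Real.logb 2 ma) + b ^ 2 * (3 - Real.logb 2 mb) := by
  have hm0 : 0 < m := by linarith
  have hs : 0 < a + b := by linarith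
  have hL : 0 < Real.log 2 := Real.log_pos (by norm_num)
  -- This is `log z ≤ z - 1` at the ratio `z` of the relative mass `x/m` to the relative weight
  -- `w/(a+b)²`. The weights `2ab`, `a²`, `b²` add up to `(a+b)²`, so the right-hand sides sum to at
  -- most `0`.
  have gibbs {w x : ℝ} (hw : 0 < w) (hx : 0 < x) :
      w * (Real.log x + 2 * Real.log (a + b) - Real.log w - Real.log m) ≤
        (a + b) ^ 2 * x / m - w := by
    have h := Real.log_le_sub_one_of_pos (x := x * (a + b) ^ 2 / (w * m)) (by positivity)
    rw [Real.log_div (by positivity) (by positivity), Real.log_mul (by positivity) (by positivity),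
      Real.log_mul (by positivity) (by positivity), Real.log_pow] at h
    have h2 := mul_le_mul_of_nonneg_left h hw.le
    have e : w * (x * (a + b) ^ 2 / (w * m) - 1) = (a + b) ^ 2 * x / m - w := by
      field_simp
    rw [e] at h2
    push_cast at h2
    linarith
  have g1 := gibbs (w := 2 * (a * b)) (by positivity) hp
  have g2 := gibbs (w := a ^ 2) (by positivity) hma
  have g3 := gibbs (w := b ^ 2) (by positivity) hmb
  have g4 : (a + b) ^ 2 * p / m + (a + b) ^ 2 * ma / m + (a + b) ^ 2 * mb / m ≤ (a + b) ^ 2 := by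
    rw [← add_div, ← add_div, div_le_iff₀ hm0, ← mul_add, ← mul_add]
    gcongr
  rw [Real.log_mul (by positivity) (by positivity), Real.log_mul (by positivity) (by positivity)]
    at g1
  rw [Real.log_pow] at g2 g3
  push_cast at g2 g3
  -- With `s = a/(a+b)`, the distribution `s², (1-s)², 2s(1-s)` has entropy `2h(s) - 2s(1-s)` bits.
  -- The budget needs this to be at least `6s(1-s)`, where `6 = 3 · 2` comes from `(a+b)² - a² - b²
  -- = 2ab`. That is exactly `h(s) ≥ 4s(1-s)`.
  have he := four_mul_log_two_le_binEntropy (t := a / (a + b)) (by positivity)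
    (by rw [div_le_one hs]; linarith)
  have h1t : 1 - a / (a + b) = b / (a + b) := by field_simp; ring
  rw [Real.binEntropy, h1t, Real.log_inv, Real.log_inv, Real.log_div ha.ne' hs.ne',
    Real.log_div hb.ne' hs.ne'] at he
  have he2 := mul_le_mul_of_nonneg_left he (sq_nonneg (a + b))
  have e1 : (a + b) ^ 2 * (4 * Real.log 2 * (a / (a + b) * (b / (a + b)))) =
      4 * Real.log 2 * (a * b) := by field_simp
  have e2 : (a + b) ^ 2 * (a / (a + b) * -(Real.log a - Real.log (a + b)) +
      b / (a + b) * -(Real.log b - Real.log (a + b))) =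
      (a + b) * (a * (Real.log (a + b) - Real.log a) + b * (Real.log (a + b) - Real.log b)) := by
    field_simp; ring
  rw [e1, e2] at he2
  simp only [Real.logb]
  rw [← mul_le_mul_iff_left₀ hL]
  have f1 : (a + b) ^ 2 * (3 - Real.log m / Real.log 2) * Real.log 2 =
      (a + b) ^ 2 * (3 * Real.log 2 - Real.log m) := by field_simp
  have f2 : (2 * (a * b) * -(Real.log p / Real.log 2) + a ^ 2 * (3 - Real.log ma / Real.log 2) +
      b ^ 2 * (3 - Real.log mb / Real.log 2)) * Real.log 2 =
      2 * (a * b) * -Real.log p + a ^ 2 * (3 * Real.log 2 - Real.log ma) +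
      b ^ 2 * (3 * Real.log 2 - Real.log mb) := by field_simp
  rw [f1, f2]
  nlinarith [g1, g2, g3, g4, he2]

/-! ### Every code has entropy at least three bits -/

section LowerBound

variable {Ω : Type*} [MeasurableSpace Ω] {P : Measure Ω} [IsProbabilityMeasure P]
  {X : Fin 2 → Ω → ℝ} {Y : Ω → ℝ}

/-- The point mass at `y` of the law of `Y`. -/
def pointMass (P : Measure Ω) (Y : Ω → ℝ) (y : ℝ) : ℝ := P.real (Y ⁻¹' {y})

omit [IsProbabilityMeasure P] in
lemma pointMass_nonneg (y : ℝ) : 0 ≤ pointMass P Y y := measureReal_nonneg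

lemma pointMass_le_one (y : ℝ) : pointMass P Y y ≤ 1 := measureReal_le_one

lemma finite_le_pointMass (hY : Measurable Y) {ε : ℝ} (hε : 0 < ε) :
    {y | ε ≤ pointMass P Y y}.Finite := by
  have h := Measure.finite_const_le_meas_of_disjoint_iUnion P (ε := ENNReal.ofReal ε)
    (by simpa using hε) (As := fun y : ℝ => Y ⁻¹' {y}) (fun y => hY (measurableSet_singleton y))
    (fun a b hab => Disjoint.preimage _ (by simpa using hab)) (measure_ne_top _ _)
  refine h.subset fun y hy => ?_
  exact (ENNReal.ofReal_le_iff_le_toReal (measure_ne_top _ _)).2 hy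

lemma countable_pointMass_ne_zero (hY : Measurable Y) : {y | pointMass P Y y ≠ 0}.Countable := by
  refine (Set.countable_iUnion fun n : ℕ =>
    (finite_le_pointMass (P := P) hY (Nat.one_div_pos_of_nat (α := ℝ) (n := n))).countable).mono ?_
  intro y hy
  obtain ⟨n, hn⟩ := exists_nat_one_div_lt ((pointMass_nonneg y).lt_of_ne' hy)
  exact Set.mem_iUnion.2 ⟨n, hn.le⟩

lemma measurable_pointMass (hY : Measurable Y) : Measurable (pointMass P Y) :=
  (measurable_const (a := (0 : ℝ))).measurable_of_countable_ne
    ((countable_pointMass_ne_zero (P := P) hY).mono fun _ h => Ne.symm h)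

/-- The information content, in bits, of the value of `Y`. -/
def surprise (P : Measure Ω) (Y : Ω → ℝ) (ω : Ω) : ℝ≥0∞ :=
  ENNReal.ofReal (-Real.logb 2 (pointMass P Y (Y ω)))

/-- Discreteness enters here: the values of mass zero inside a countable set together form a null
event. -/
lemma ae_pointMass_pos (hY : ∃ S : Set ℝ, S.Countable ∧ ∀ᵐ ω ∂P, Y ω ∈ S) :
    ∀ᵐ ω ∂P, 0 < pointMass P Y (Y ω) := by
  obtain ⟨S, hS, hYS⟩ := hY
  have h : ∀ᵐ ω ∂P, ∀ y ∈ S, pointMass P Y y = 0 → Y ω ≠ y := by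
    rw [ae_ball_iff hS]
    intro y _
    by_cases h0 : pointMass P Y y = 0
    · rw [pointMass, measureReal_eq_zero_iff] at h0
      have : ∀ᵐ ω ∂P, Y ω ≠ y := by
        rw [ae_iff]
        simp only [ne_eq, not_not]
        exact h0
      filter_upwards [this] with ω hω _ using hω
    · exact Filter.Eventually.of_forall fun _ h => absurd h h0
  filter_upwards [hYS, h] with ω h1 h2
  exact (pointMass_nonneg _).lt_of_ne' fun h0 => h2 _ h1 h0 rfl

lemma lintegral_surprise_le_entropyBits (hY : Measurable Y)
    (hd : ∃ S : Set ℝ, S.Countable ∧ ∀ᵐ ω ∂P, Y ω ∈ S) :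
    ∫⁻ ω, surprise P Y ω ∂P ≤ entropyBits P Y := by
  obtain ⟨S, hS, hYS⟩ := hd
  set g : ℝ → ℝ≥0∞ := fun y => ENNReal.ofReal (-Real.logb 2 (pointMass P Y y)) with hg
  have hgm : Measurable g :=
    (((Real.measurable_log.comp (measurable_pointMass (P := P) hY)).div_const _).neg).ennreal_ofReal
  have h1 : ∫⁻ ω, surprise P Y ω ∂P = ∫⁻ y, g y ∂(P.map Y) := (lintegral_map hgm hY).symm
  have h2 : (P.map Y).restrict S = P.map Y := by
    refine Measure.restrict_eq_self_of_ae_mem ?_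
    exact (ae_map_iff hY.aemeasurable hS.measurableSet).2 hYS
  rw [h1, ← h2, lintegral_countable _ hS, entropyBits]
  have h3 (y : ℝ) : g y * (P.map Y) {y} =
      ENNReal.ofReal (-(P.real (Y ⁻¹' {y}) * Real.logb 2 (P.real (Y ⁻¹' {y})))) := by
    rw [Measure.map_apply hY (measurableSet_singleton y), ← ofReal_measureReal, mul_comm,
      ← ENNReal.ofReal_mul measureReal_nonneg, mul_neg]
    rfl
  calc ∑' y : S, g y * (P.map Y) {(y : ℝ)}
      = ∑' y : S, (fun y : ℝ => ENNReal.ofReal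
          (-(P.real (Y ⁻¹' {y}) * Real.logb 2 (P.real (Y ⁻¹' {y}))))) y := by
        exact tsum_congr fun y => h3 y
    _ ≤ _ := ENNReal.tsum_comp_le_tsum_of_injective Subtype.val_injective _

variable (hX : IsUniformPair P X) (hY : Measurable Y)
  (hsep : ∀ᵐ ω ∂P, Separates (Y ω) (ordered fun i => X i ω))
  (hpos : ∀ᵐ ω ∂P, 0 < pointMass P Y (Y ω))

omit [IsProbabilityMeasure P] in
include hsep in
lemma ae_mem_Ioo_of_mem_box (l u : ℝ) : ∀ᵐ ω ∂P, ω ∈ box X l u → Y ω ∈ Set.Ioo l u := by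
  filter_upwards [hsep] with ω h hω
  have h0 := hω 0
  have h1 := hω 1
  exact ⟨(lt_min h0.1 h1.1).trans_le h.1, h.2.trans_le (max_le h0.2 h1.2)⟩

include hX hsep in
lemma measure_Ioo_pos {l u : ℝ} (hl : 0 ≤ l) (hlu : l < u) (hu : u ≤ 1) :
    0 < P.real (Y ⁻¹' Set.Ioo l u) := by
  have h : P (box X l u) ≤ P (Y ⁻¹' Set.Ioo l u) :=
    measure_mono_ae (ae_mem_Ioo_of_mem_box hsep l u)
  rw [hX.prob_box hl hlu.le hu] at h
  have h2 : 0 < (u - l) ^ 2 := pow_pos (by linarith) 2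
  exact ENNReal.toReal_pos ((ENNReal.ofReal_pos.2 h2).trans_le h).ne' (measure_ne_top _ _)

include hpos in
lemma setLIntegral_surprise_ge {E : Set Ω} (hE : MeasurableSet E) {m : ℝ} (hm1 : m ≤ 1)
    (hm : ∀ᵐ ω ∂P, ω ∈ E → pointMass P Y (Y ω) ≤ m) :
    ENNReal.ofReal (P.real E * -Real.logb 2 m) ≤ ∫⁻ ω in E, surprise P Y ω ∂P := by
  rw [mul_comm]
  by_cases hm0 : 0 < m
  swap
  · have : P E = 0 := by
      rw [measure_eq_zero_iff_ae_notMem]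
      filter_upwards [hpos, hm] with ω h1 h2 h3
      exact hm0 (h1.trans_le (h2 h3))
    simp [measureReal_def, this]
  have hlog : 0 ≤ -Real.logb 2 m := by
    rw [neg_nonneg]; exact Real.logb_nonpos (by norm_num) hm0.le hm1
  rw [ENNReal.ofReal_mul hlog, ofReal_measureReal, ← setLIntegral_const]
  refine setLIntegral_mono_ae' hE ?_
  filter_upwards [hpos, hm] with ω h1 h2 h3
  refine ENNReal.ofReal_le_ofReal (neg_le_neg ?_)
  exact Real.logb_le_logb_of_le (by norm_num) h1 (h2 h3)

-- Induction on the number of atoms of mass at least `ε` in `(l,u)`. When none is left, the error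
-- term covers the whole box and cancels the constant `3`; what remains is the trivial bound that no
-- atom in `(l,u)` outweighs `P(Y ∈ (l,u))`. Otherwise the heaviest atom splits the box, and
-- `split_budget` combines the pieces.
include hX hY hsep hpos in
lemma budget_le_setLIntegral_surprise {ε : ℝ} (hε : 0 < ε) (n : ℕ) {l u : ℝ} (hl : 0 ≤ l)
    (hlu : l < u) (hu : u ≤ 1)
    (hn : (Set.Ioo l u ∩ {y | ε ≤ pointMass P Y y}).ncard ≤ n) :
    ENNReal.ofReal ((u - l) ^ 2 * (3 - Real.logb 2 (P.real (Y ⁻¹' Set.Ioo l u))) -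
      3 * P.real (box X l u ∩ {ω | pointMass P Y (Y ω) < ε})) ≤
      ∫⁻ ω in box X l u, surprise P Y ω ∂P := by
  induction n generalizing l u with
  | zero =>
    have hfin : (Set.Ioo l u ∩ {y | ε ≤ pointMass P Y y}).Finite :=
      (finite_le_pointMass hY hε).subset Set.inter_subset_right
    have hempty := (Set.ncard_eq_zero hfin).1 (Nat.le_zero.1 hn)
    have hbox : P.real (box X l u) = (u - l) ^ 2 := by
      rw [measureReal_def, hX.prob_box hl hlu.le hu, ENNReal.toReal_ofReal (sq_nonneg _)]
    have hR : P.real (box X l u ∩ {ω | pointMass P Y (Y ω) < ε}) = (u - l) ^ 2 := by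
      rw [← hbox]
      refine measureReal_congr ?_
      filter_upwards [ae_mem_Ioo_of_mem_box hsep l u] with ω hω
      refine propext ⟨fun h => h.1, fun h => ⟨h, ?_⟩⟩
      by_contra hlt
      have : Y ω ∈ Set.Ioo l u ∩ {y | ε ≤ pointMass P Y y} := 
        ⟨hω h, (not_lt.1 hlt : ε ≤ _)⟩
      rw [hempty] at this
      exact this
    rw [hR, show (u - l) ^ 2 * (3 - Real.logb 2 (P.real (Y ⁻¹' Set.Ioo l u))) -
      3 * (u - l) ^ 2 = (u - l) ^ 2 * -Real.logb 2 (P.real (Y ⁻¹' Set.Ioo l u)) by ring, ← hbox]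
    refine setLIntegral_surprise_ge hpos (measurableSet_box hX.measurable l u) measureReal_le_one ?_
    filter_upwards [ae_mem_Ioo_of_mem_box hsep l u] with ω hω h
    exact measureReal_mono (Set.preimage_mono (Set.singleton_subset_iff.2 (hω h)))
  | succ n ih =>
    have hfin : (Set.Ioo l u ∩ {y | ε ≤ pointMass P Y y}).Finite :=
      (finite_le_pointMass hY hε).subset Set.inter_subset_right
    rcases (Set.Ioo l u ∩ {y | ε ≤ pointMass P Y y}).eq_empty_or_nonempty with he | hne
    · exact ih hl hlu hu (by simp [he])
    obtain ⟨t, ⟨⟨hlt, htu⟩, htε⟩, htmax⟩ := Set.exists_max_image _ (pointMass P Y) hfin hne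
    have hmax (y : ℝ) (hy : y ∈ Set.Ioo l u) : pointMass P Y y ≤ pointMass P Y t := by
      rcases le_or_gt ε (pointMass P Y y) with h | h
      · exact htmax y ⟨hy, h⟩
      · exact h.le.trans htε
    have card_le {a b : ℝ} (ha : l ≤ a) (hb : b ≤ u) (ht : t ∉ Set.Ioo a b) :
        (Set.Ioo a b ∩ {y | ε ≤ pointMass P Y y}).ncard ≤ n := by
      refine Nat.lt_succ_iff.1 (lt_of_lt_of_le (Set.ncard_lt_ncard ?_ hfin) hn)
      refine (Set.ssubset_iff_of_subset ?_).2 ⟨t, ⟨⟨hlt, htu⟩, htε⟩, fun h => ht h.1⟩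
      exact Set.inter_subset_inter_left _ (Set.Ioo_subset_Ioo ha hb)
    have ih1 := ih hl hlt (htu.le.trans hu) (card_le le_rfl htu.le fun h => h.2.false)
    have ih2 := ih (hl.trans hlt.le) htu hu (card_le hlt.le le_rfl fun h => h.1.false)
    have hbm := measurableSet_box hX.measurable
    have hsm := measurableSet_split hX.measurable l t u
    have hd1 : Disjoint (box X l t) (box X t u) := by
      rw [Set.disjoint_left]
      intro ω h1 h2
      exact absurd (h1 0).2 (not_le.2 (h2 0).1)
    have hd2 : Disjoint (box X l t ∪ box X t u) (split X l t u) := by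
      rw [Set.disjoint_left]
      rintro ω (h1 | h1) (h2 | h2)
      · exact absurd (h1 1).2 (not_le.2 h2.2.1)
      · exact absurd (h1 0).2 (not_le.2 h2.1.1)
      · exact absurd h2.1.2 (not_le.2 (h1 0).1)
      · exact absurd h2.2.2 (not_le.2 (h1 1).1)
    have hsub1 : box X l t ⊆ box X l u := fun ω h i => ⟨(h i).1, (h i).2.trans htu.le⟩
    have hsub2 : box X t u ⊆ box X l u := fun ω h i => ⟨hlt.trans (h i).1, (h i).2⟩
    have hint : ∫⁻ ω in box X l t, surprise P Y ω ∂P + ∫⁻ ω in box X t u, surprise P Y ω ∂P +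
        ∫⁻ ω in split X l t u, surprise P Y ω ∂P ≤ ∫⁻ ω in box X l u, surprise P Y ω ∂P := by
      rw [← lintegral_union (hbm t u) hd1, ← lintegral_union hsm hd2]
      exact lintegral_mono_set (Set.union_subset (Set.union_subset hsub1 hsub2) split_subset_box)
    have hsplit : P.real (split X l t u) = 2 * ((t - l) * (u - t)) := by
      rw [measureReal_def, hX.prob_split hl hlt.le htu.le hu, ENNReal.toReal_ofReal]
      exact mul_nonneg zero_le_two (mul_nonneg (by linarith) (by linarith))
    have h3 := setLIntegral_surprise_ge (P := P) (Y := Y) hpos hsm (pointMass_le_one t) (by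
      filter_upwards [ae_mem_Ioo_of_mem_box hsep l u] with ω hω h
      exact hmax _ (hω (split_subset_box h)))
    rw [hsplit] at h3
    have hR : P.real (box X l t ∩ {ω | pointMass P Y (Y ω) < ε}) +
        P.real (box X t u ∩ {ω | pointMass P Y (Y ω) < ε}) ≤
        P.real (box X l u ∩ {ω | pointMass P Y (Y ω) < ε}) := by
      have hm : MeasurableSet {ω | pointMass P Y (Y ω) < ε} :=
        measurableSet_lt ((measurable_pointMass hY).comp hY) measurable_const
      rw [← measureReal_union (hd1.mono Set.inter_subset_left Set.inter_subset_left)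
        ((hbm t u).inter hm), ← Set.union_inter_distrib_right]
      exact measureReal_mono (Set.inter_subset_inter_left _ (Set.union_subset hsub1 hsub2))
    have hmass : pointMass P Y t + P.real (Y ⁻¹' Set.Ioo l t) + P.real (Y ⁻¹' Set.Ioo t u) ≤
        P.real (Y ⁻¹' Set.Ioo l u) := by
      rw [pointMass, ← measureReal_union _ (hY measurableSet_Ioo),
        ← measureReal_union _ (hY measurableSet_Ioo), ← Set.preimage_union, ← Set.preimage_union]
      · refine measureReal_mono (Set.preimage_mono (Set.union_subset (Set.union_subset ?_ ?_) ?_))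
        · exact Set.singleton_subset_iff.2 ⟨hlt, htu⟩
        · exact Set.Ioo_subset_Ioo le_rfl htu.le
        · exact Set.Ioo_subset_Ioo hlt.le le_rfl
      · rw [← Set.preimage_union]
        refine Disjoint.preimage _ (Set.disjoint_left.2 ?_)
        rintro x (rfl | hx) hx'
        · exact hx'.1.false
        · exact absurd hx.2 (not_lt.2 hx'.1.le)
      · refine Disjoint.preimage _ (Set.disjoint_left.2 ?_)
        rintro x rfl hx'
        exact hx'.2.false
    have hb := split_budget (a := t - l) (b := u - t) (by linarith) (by linarith) (hε.trans_le htε)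
      (measure_Ioo_pos hX hsep hl hlt (htu.le.trans hu))
      (measure_Ioo_pos hX hsep (hl.trans hlt.le) htu hu) hmass
    rw [show t - l + (u - t) = u - l by ring] at hb
    refine le_trans ?_ ((add_le_add (add_le_add ih1 ih2) h3).trans hint)
    -- Truncation at zero is harmless: `ENNReal.ofReal` is subadditive, so the real inequality
    -- suffices even if some bounds are negative.
    refine le_trans ?_ ((ENNReal.ofReal_add_le.trans (add_le_add_left ENNReal.ofReal_add_le _)))
    refine ENNReal.ofReal_le_ofReal ?_
    linarith

-- The budget on the unit interval is at least `3`, since `log₂ m ≤ 0`. The error is at most three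
-- times the probability that the mass of `Y`'s value is below `1/(n+1)`, and this tends to `0`
-- because that mass is almost surely positive.
include hX hY hsep hpos in
lemma three_le_lintegral_surprise : 3 ≤ ∫⁻ ω, surprise P Y ω ∂P := by
  set A : ℕ → Set Ω := fun n => {ω | pointMass P Y (Y ω) < 1 / ((n : ℝ) + 1)} with hA
  have hAm (n : ℕ) : MeasurableSet (A n) :=
    measurableSet_lt ((measurable_pointMass hY).comp hY) measurable_const
  have hlim : Filter.Tendsto (fun n => P (A n)) Filter.atTop (nhds 0) := by
    have h := tendsto_measure_iInter_atTop (μ := P) (s := A) (fun n => (hAm n).nullMeasurableSet)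
      (fun m n hmn ω (hω : pointMass P Y (Y ω) < _) =>
        (lt_of_lt_of_le hω (Nat.one_div_le_one_div hmn) : pointMass P Y (Y ω) < _)) ⟨0, measure_ne_top _ _⟩
    have h0 : P (⋂ n, A n) = 0 := by
      rw [measure_eq_zero_iff_ae_notMem]
      filter_upwards [hpos] with ω hω h
      obtain ⟨n, hn⟩ := exists_nat_one_div_lt hω
      exact lt_asymm hn (Set.mem_iInter.1 h n)
    rwa [h0] at h
  have hlim' : Filter.Tendsto (fun n => ENNReal.ofReal (3 - 3 * P.real (A n))) Filter.atTop
      (nhds (ENNReal.ofReal (3 - 3 * 0))) := by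
    refine ENNReal.tendsto_ofReal ((Filter.Tendsto.const_mul 3 ?_).const_sub 3)
    exact (ENNReal.tendsto_toReal ENNReal.zero_ne_top).comp hlim
  have e : ENNReal.ofReal (3 - 3 * 0) = 3 := by norm_num
  rw [e] at hlim'
  refine le_of_tendsto' hlim' fun n => ?_
  have hb := budget_le_setLIntegral_surprise hX hY hsep hpos
    (Nat.one_div_pos_of_nat (α := ℝ) (n := n)) _ le_rfl zero_lt_one le_rfl le_rfl
  refine le_trans (ENNReal.ofReal_le_ofReal ?_) (hb.trans (setLIntegral_le_lintegral _ _))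
  have h1 : P.real (box X 0 1 ∩ A n) ≤ P.real (A n) := measureReal_mono Set.inter_subset_right
  have h2 : Real.logb 2 (P.real (Y ⁻¹' Set.Ioo 0 1)) ≤ 0 :=
    Real.logb_nonpos (by norm_num) measureReal_nonneg measureReal_le_one
  simp only [hA] at h1 ⊢
  linarith

include hX in
theorem three_le_entropyBits_of_isCode {C : ℝ × ℝ → ℝ} (hC : IsCode P X C) :
    3 ≤ entropyBits P (threshold X C) := by
  have hY : Measurable (threshold X C) := hC.measurable.comp (measurable_ordered hX.measurable)
  refine (three_le_lintegral_surprise hX hY ?_ (ae_pointMass_pos hC.discrete)).trans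
    (lintegral_surprise_le_entropyBits hY hC.discrete)
  filter_upwards [hX.ae_mem_Ioc, hX.ae_ne] with ω h01 hne
  exact hC.separates _ _ (le_min (h01 0).1.le (h01 1).1.le) (min_lt_max.2 hne)
    (max_le (h01 0).2 (h01 1).2)

end LowerBound

/-! ### Dyadic enumerations -/

/-- The dyadic fractions with denominator `2 ^ n` in the open unit interval. -/
def dyadicGrid (n : ℕ) : Finset ℝ := (Finset.Ioo 0 (2 ^ n)).image fun i : ℕ => (i : ℝ) / 2 ^ n

lemma mem_dyadicGrid {n : ℕ} {t : ℝ} :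
    t ∈ dyadicGrid n ↔ ∃ i : ℕ, (0 < i ∧ i < 2 ^ n) ∧ (i : ℝ) / 2 ^ n = t := by
  simp [dyadicGrid]

lemma natCast_div_two_pow_inj {n i j : ℕ} (h : (i : ℝ) / 2 ^ n = (j : ℝ) / 2 ^ n) : i = j := by
  have := (div_left_inj' (by positivity)).1 h
  exact_mod_cast this

lemma card_dyadicGrid (n : ℕ) : (dyadicGrid n).card = 2 ^ n - 1 := by
  rw [dyadicGrid, Finset.card_image_of_injective _ fun i j h => natCast_div_two_pow_inj h,
    Nat.card_Ioo, Nat.sub_zero]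

lemma dyadicGrid_mono : Monotone dyadicGrid := by
  refine monotone_nat_of_le_succ fun n t ht => ?_
  obtain ⟨i, ⟨h0, h1⟩, rfl⟩ := mem_dyadicGrid.1 ht
  refine mem_dyadicGrid.2 ⟨2 * i, ⟨by omega, by rw [pow_succ]; omega⟩, ?_⟩
  push_cast
  rw [pow_succ]
  field_simp

lemma mem_Ioo_of_mem_dyadicGrid {n : ℕ} {t : ℝ} (ht : t ∈ dyadicGrid n) : t ∈ Set.Ioo (0 : ℝ) 1 := by
  obtain ⟨i, ⟨h0, h1⟩, rfl⟩ := mem_dyadicGrid.1 ht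
  refine ⟨by positivity, (div_lt_one (by positivity)).2 (by exact_mod_cast h1)⟩

lemma odd_div_mem_dyadicGrid {n i : ℕ} (hi : i < 2 ^ n) :
    ((i : ℝ) / 2 ^ n + ((i : ℝ) + 1) / 2 ^ n) / 2 ∈ dyadicGrid (n + 1) := by
  refine mem_dyadicGrid.2 ⟨2 * i + 1, ⟨by omega, by rw [pow_succ]; omega⟩, ?_⟩
  push_cast
  rw [pow_succ]
  field_simp
  ring

lemma eq_midpoint_of_mem_dyadicGrid {n i : ℕ} {t : ℝ} (ht : t ∈ dyadicGrid (n + 1))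
    (hl : (i : ℝ) / 2 ^ n < t) (hu : t < ((i : ℝ) + 1) / 2 ^ n) :
    t = ((i : ℝ) / 2 ^ n + ((i : ℝ) + 1) / 2 ^ n) / 2 := by
  obtain ⟨a, -, rfl⟩ := mem_dyadicGrid.1 ht
  have h2 : (0 : ℝ) < 2 ^ n := by positivity
  rw [pow_succ] at *
  rw [div_lt_div_iff₀ h2 (by positivity)] at hl
  rw [div_lt_div_iff₀ (by positivity) h2] at hu
  have hl' : (i : ℝ) * 2 < a := by nlinarith
  have hu' : (a : ℝ) < ((i : ℝ) + 1) * 2 := by nlinarith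
  have e : a = 2 * i + 1 := by
    have h3 : i * 2 < a := by exact_mod_cast hl'
    have h4 : a < (i + 1) * 2 := by exact_mod_cast hu'
    omega
  subst e
  push_cast
  field_simp
  ring

lemma odd_div_notMem_dyadicGrid {n i : ℕ} :
    ((i : ℝ) / 2 ^ n + ((i : ℝ) + 1) / 2 ^ n) / 2 ∉ dyadicGrid n := by
  intro h
  obtain ⟨a, -, h⟩ := mem_dyadicGrid.1 h
  field_simp at h
  have h' : a * 2 = i + (i + 1) := by
    have h2 : ((a * 2 : ℕ) : ℝ) = ((i + (i + 1) : ℕ) : ℝ) := by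
      push_cast
      linarith
    exact_mod_cast h2
  omega

lemma exists_eq_midpoint_of_mem_dyadicGrid {n : ℕ} {t : ℝ} (ht : t ∈ dyadicGrid (n + 1))
    (ht' : t ∉ dyadicGrid n) :
    ∃ i : ℕ, i < 2 ^ n ∧ t = ((i : ℝ) / 2 ^ n + ((i : ℝ) + 1) / 2 ^ n) / 2 := by
  obtain ⟨a, ⟨h0, h1⟩, rfl⟩ := mem_dyadicGrid.1 ht
  rcases Nat.even_or_odd' a with ⟨i, rfl | rfl⟩
  · refine absurd (mem_dyadicGrid.2 ⟨i, ⟨by omega, by rw [pow_succ] at h1; omega⟩, ?_⟩) ht'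
    push_cast
    rw [pow_succ]
    field_simp
  · refine ⟨i, by rw [pow_succ] at h1; omega, ?_⟩
    push_cast
    rw [pow_succ]
    field_simp
    ring

lemma exists_mem_dyadicGrid_between {a b : ℝ} (ha : 0 ≤ a) (hab : a < b) (hb : b ≤ 1) :
    ∃ n, ∃ t ∈ dyadicGrid n, a < t ∧ t < b := by
  obtain ⟨n, hn⟩ := exists_pow_lt_of_lt_one (sub_pos.2 hab) (show (2⁻¹ : ℝ) < 1 by norm_num)
  have h2 : (0 : ℝ) < 2 ^ n := by positivity
  rw [inv_pow, inv_lt_iff_one_lt_mul₀' h2] at hn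
  have hf := Nat.floor_le (mul_nonneg ha h2.le)
  have hf' := Nat.lt_floor_add_one (a * 2 ^ n)
  have h1 : ((⌊a * 2 ^ n⌋₊ + 1 : ℕ) : ℝ) < b * 2 ^ n := by
    push_cast; linarith
  refine ⟨n, ((⌊a * 2 ^ n⌋₊ + 1 : ℕ) : ℝ) / 2 ^ n, mem_dyadicGrid.2
    ⟨_, ⟨Nat.succ_pos _, ?_⟩, rfl⟩, ?_, ?_⟩
  · have : ((⌊a * 2 ^ n⌋₊ + 1 : ℕ) : ℝ) < ((2 ^ n : ℕ) : ℝ) := by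
      refine h1.trans_le ?_
      push_cast
      exact mul_le_of_le_one_left h2.le hb
    exact_mod_cast this
  · rw [lt_div_iff₀ h2]; push_cast; exact hf'
  · rw [div_lt_iff₀ h2]; exact h1

/-- At stage `k` the sequence takes a new value in the coarsest dyadic grid that still has one. -/
def IsDyadicStage (y : ℕ → ℝ) (k : ℕ) : Prop :=
  y k ∈ dyadicGrid (Nat.log 2 (k + 1) + 1) ∧ ∀ j < k, y j ≠ y k

/-- The grid of denominator `2^n` has `2^n - 1` interior points, so it is used up exactly by the
stages `k < 2^n - 1`. Counting from `0` causes the shift to `k + 1`. -/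
lemma log_succ_lt_iff {k n : ℕ} : Nat.log 2 (k + 1) < n ↔ k < 2 ^ n - 1 := by
  rw [Nat.log_lt_iff_lt_pow (by norm_num) (by omega)]
  omega

lemma IsDyadicStage.mem_dyadicGrid {y : ℕ → ℝ} {k n : ℕ} (h : IsDyadicStage y k)
    (hk : k < 2 ^ n - 1) : y k ∈ dyadicGrid n :=
  dyadicGrid_mono (Nat.succ_le_of_lt (log_succ_lt_iff.2 hk)) h.1

/-- Once enough stages have passed, every point of a dyadic grid has been taken. -/
lemma exists_eq_of_mem_dyadicGrid {y : ℕ → ℝ} {n : ℕ}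
    (hy : ∀ j < 2 ^ n - 1, IsDyadicStage y j) {t : ℝ} (ht : t ∈ dyadicGrid n) :
    ∃ j < 2 ^ n - 1, y j = t := by
  classical
  have hinj : Set.InjOn y (Finset.range (2 ^ n - 1)) := by
    intro i hi j hj hij
    rw [Finset.mem_coe, Finset.mem_range] at hi hj
    rcases lt_trichotomy i j with h | h | h
    · exact absurd hij ((hy j hj).2 i h)
    · exact h
    · exact absurd hij.symm ((hy i hi).2 j h)
  have hsub : (Finset.range (2 ^ n - 1)).image y ⊆ dyadicGrid n := by
    intro s hs
    obtain ⟨j, hj, rfl⟩ := Finset.mem_image.1 hs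
    exact (hy j (Finset.mem_range.1 hj)).mem_dyadicGrid (Finset.mem_range.1 hj)
  have heq := Finset.eq_of_subset_of_card_le hsub (by
    rw [card_dyadicGrid, Finset.card_image_of_injOn hinj, Finset.card_range])
  rw [← heq] at ht
  obtain ⟨j, hj, e⟩ := Finset.mem_image.1 ht
  exact ⟨j, Finset.mem_range.1 hj, e⟩

lemma range_eq_iUnion_dyadicGrid {y : ℕ → ℝ} (hy : ∀ k, IsDyadicStage y k) :
    Set.range y = ⋃ n, (dyadicGrid n : Set ℝ) := by
  ext t
  simp only [Set.mem_range, Set.mem_iUnion, Finset.mem_coe]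
  constructor
  · rintro ⟨k, rfl⟩
    exact ⟨_, (hy k).1⟩
  · rintro ⟨n, hn⟩
    obtain ⟨j, -, e⟩ := exists_eq_of_mem_dyadicGrid (fun j _ => hy j) hn
    exact ⟨j, e⟩

lemma injective_of_isDyadicStage {y : ℕ → ℝ} (hy : ∀ k, IsDyadicStage y k) :
    Function.Injective y := by
  intro i j hij
  rcases lt_trichotomy i j with h | h | h
  · exact absurd hij ((hy j).2 i h)
  · exact h
  · exact absurd hij.symm ((hy i).2 j h)

/-- Each level is traversed from right to left, so the cell index `i` decreases as `k` grows and `i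
+ k` is constant on the level. -/
lemma exists_dyadicThreshold_eq (k : ℕ) :
    ∃ i : ℕ, i + (k + 1) + 1 = 2 ^ (Nat.log 2 (k + 1) + 1) ∧ i < 2 ^ Nat.log 2 (k + 1) ∧
      dyadicThreshold k = ((i : ℝ) / 2 ^ Nat.log 2 (k + 1) +
        ((i : ℝ) + 1) / 2 ^ Nat.log 2 (k + 1)) / 2 := by
  have h1 : 2 ^ Nat.log 2 (k + 1) ≤ k + 1 := Nat.pow_log_le_self 2 (by omega)
  have h2 : k + 1 < 2 ^ (Nat.log 2 (k + 1) + 1) := Nat.lt_pow_succ_log_self (by norm_num) _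
  obtain ⟨i, hi⟩ := Nat.exists_eq_add_of_lt h2
  refine ⟨i, by omega, by rw [pow_succ] at hi; omega, ?_⟩
  have hi' : (2 : ℝ) ^ (Nat.log 2 (k + 1) + 1) = k + 1 + i + 1 := by exact_mod_cast hi
  rw [dyadicThreshold, div_eq_iff (by positivity)]
  rw [show (2 : ℝ) ^ (Nat.log 2 (k + 1) + 1) - ((k : ℝ) + 1) = i + 1 by rw [hi']; ring, pow_succ]
  field_simp
  ring

lemma isDyadicStage_dyadicThreshold (k : ℕ) : IsDyadicStage dyadicThreshold k := by
  have hmem (k : ℕ) : dyadicThreshold k ∈ dyadicGrid (Nat.log 2 (k + 1) + 1) := by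
    obtain ⟨i, -, hi, e⟩ := exists_dyadicThreshold_eq k
    rw [e]
    exact odd_div_mem_dyadicGrid hi
  refine ⟨hmem k, fun j hj he => ?_⟩
  obtain ⟨i, hik, -, e⟩ := exists_dyadicThreshold_eq k
  obtain ⟨i', hij, -, e'⟩ := exists_dyadicThreshold_eq j
  rcases (Nat.log_mono_right (b := 2) (Nat.succ_le_succ hj.le)).lt_or_eq with hlt | heq
  · have := dyadicGrid_mono (Nat.succ_le_of_lt hlt) (hmem j)
    rw [he, e] at this
    exact odd_div_notMem_dyadicGrid this
  · simp only [Nat.succ_eq_add_one] at heq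
    rw [heq] at hij e'
    rw [e, e'] at he
    field_simp at he
    have : i' = i := by
      have h3 : (i' : ℝ) = i := by linarith
      exact_mod_cast h3
    omega

/-! ### Thresholds that maximize the probability of separation -/

section Thresholds

variable {Ω : Type*} [MeasurableSpace Ω] {P : Measure Ω} {X : Fin 2 → Ω → ℝ} {y : ℕ → ℝ}

omit [MeasurableSpace Ω] in
/-- A pair that is separated by `t`, but by no point of the grid around `t`, lies in the grid cell
of `t`. -/
lemma mem_split_of_unresolved {n k i : ℕ} {t : ℝ}
    (hcov : ∀ s ∈ dyadicGrid n, ∃ j < k, y j = s) (hi : i < 2 ^ n) (hl : (i : ℝ) / 2 ^ n ≤ t)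
    (hu : t < ((i : ℝ) + 1) / 2 ^ n) {ω : Ω} (hω : ∀ i, X i ω ∈ Set.Ioc (0 : ℝ) 1)
    (hun : ω ∈ unresolved X y k) (hsep : Separates t (ordered fun i => X i ω)) :
    ω ∈ split X ((i : ℝ) / 2 ^ n) t (((i : ℝ) + 1) / 2 ^ n) := by
  have hgrid (s : ℝ) (hs : s ∈ dyadicGrid n) : ¬ Separates s (ordered fun i => X i ω) := by
    obtain ⟨j, hj, rfl⟩ := hcov s hs
    exact hun j hj
  have hmin : (i : ℝ) / 2 ^ n < min (X 0 ω) (X 1 ω) := by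
    -- The ends `0` and `1` of the unit interval are not grid points; at the outermost cells the
    -- bounds come from `hω` instead.
    rcases Nat.eq_zero_or_pos i with rfl | hpos
    · simpa using ⟨(hω 0).1, (hω 1).1⟩
    · by_contra hle
      exact hgrid _ (mem_dyadicGrid.2 ⟨i, ⟨hpos, hi⟩, rfl⟩) ⟨not_lt.1 hle, hl.trans_lt hsep.2⟩
  have hmax : max (X 0 ω) (X 1 ω) ≤ ((i : ℝ) + 1) / 2 ^ n := by
    rcases (Nat.succ_le_of_lt hi).eq_or_lt with he | hlt
    · have : ((i : ℝ) + 1) / 2 ^ n = 1 := by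
        rw [div_eq_one_iff_eq (by positivity)]
        exact_mod_cast he
      rw [this]
      exact max_le (hω 0).2 (hω 1).2
    · by_contra hlt'
      refine hgrid _ (mem_dyadicGrid.2 ⟨i + 1, ⟨Nat.succ_pos _, hlt⟩, rfl⟩) ?_
      push_cast
      exact ⟨hsep.1.trans hu.le, not_le.1 hlt'⟩
  rw [lt_min_iff] at hmin
  rw [max_le_iff] at hmax
  exact mem_split_iff.2 ⟨Fin.forall_fin_two.2 ⟨⟨hmin.1, hmax.1⟩, hmin.2, hmax.2⟩, hsep⟩

lemma exists_eq_of_mem_dyadicGrid_log {k : ℕ} (hy : ∀ j < k, IsDyadicStage y j) {s : ℝ}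
    (hs : s ∈ dyadicGrid (Nat.log 2 (k + 1))) : ∃ j < k, y j = s := by
  have hk : 2 ^ Nat.log 2 (k + 1) - 1 ≤ k := by
    have := Nat.pow_log_le_self 2 (x := k + 1) (by omega)
    omega
  obtain ⟨j, hj, e⟩ := exists_eq_of_mem_dyadicGrid (fun j hj => hy j (hj.trans_le hk)) hs
  exact ⟨j, hj.trans_le hk, e⟩

lemma mem_dyadicGrid_log_of_le {j k : ℕ} (hy : IsDyadicStage y j) (hjk : j ≤ k) :
    y j ∈ dyadicGrid (Nat.log 2 (k + 1) + 1) :=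
  dyadicGrid_mono (Nat.succ_le_succ (Nat.log_mono_right (Nat.succ_le_succ hjk))) hy.1

lemma cell_bounds {n i : ℕ} (hi : i < 2 ^ n) :
    0 ≤ (i : ℝ) / 2 ^ n ∧ (i : ℝ) / 2 ^ n < ((i : ℝ) + 1) / 2 ^ n ∧ ((i : ℝ) + 1) / 2 ^ n ≤ 1 ∧
      ((i : ℝ) + 1) / 2 ^ n - (i : ℝ) / 2 ^ n = (2 ^ n)⁻¹ := by
  refine ⟨by positivity, ?_, ?_, by field_simp; ring⟩
  · gcongr; linarith
  · refine div_le_one_of_le₀ ?_ (by positivity)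
    exact_mod_cast hi

/-- The earlier thresholds exhaust the coarse grid and stay in the next one, so `t` is the midpoint
of a coarse cell. An earlier threshold separating a pair in that cell would be a fine grid point
strictly inside it, hence `t` itself. The event is therefore almost surely the split of the cell at
`t`. -/
lemma IsUniformPair.prob_unresolved_separates (hX : IsUniformPair P X) {k : ℕ}
    (hy : ∀ j < k, IsDyadicStage y j) {t : ℝ} (ht : t ∈ dyadicGrid (Nat.log 2 (k + 1) + 1))
    (hne : ∀ j < k, y j ≠ t) :
    P (unresolved X y k ∩ {ω | Separates t (ordered fun i => X i ω)}) =
      ENNReal.ofReal (((2 : ℝ) ^ Nat.log 2 (k + 1))⁻¹ ^ 2 / 2) := by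
  have hcov := fun s hs => exists_eq_of_mem_dyadicGrid_log hy (s := s) hs
  have ht' : t ∉ dyadicGrid (Nat.log 2 (k + 1)) := fun h => by
    obtain ⟨j, hj, e⟩ := hcov t h
    exact hne j hj e
  obtain ⟨i, hi, e⟩ := exists_eq_midpoint_of_mem_dyadicGrid ht ht'
  obtain ⟨h0, hlt, h1, hlen⟩ := cell_bounds hi
  rw [← hlen, ← hX.prob_split_midpoint h0 hlt h1, ← e]
  refine measure_congr ?_
  filter_upwards [hX.ae_mem_Ioc] with ω hω
  refine propext ⟨fun h => mem_split_of_unresolved hcov hi (by linarith) (by linarith) hω h.1 h.2,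
    fun h => ?_⟩
  obtain ⟨hbox, hsep⟩ := mem_split_iff.1 h
  refine ⟨fun j hj hsj => hne j hj ?_, hsep⟩
  rw [e]
  exact eq_midpoint_of_mem_dyadicGrid (mem_dyadicGrid_log_of_le (hy j hj) hj.le)
    ((lt_min (hbox 0).1 (hbox 1).1).trans_le hsj.1) (hsj.2.trans_le (max_le (hbox 0).2 (hbox 1).2))

lemma IsUniformPair.prob_unresolved_separates_le (hX : IsUniformPair P X) {k : ℕ}
    (hy : ∀ j < k, IsDyadicStage y j) {t : ℝ} (ht : t ∈ Set.Icc (0 : ℝ) 1) :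
    P (unresolved X y k ∩ {ω | Separates t (ordered fun i => X i ω)}) ≤
      ENNReal.ofReal (((2 : ℝ) ^ Nat.log 2 (k + 1))⁻¹ ^ 2 / 2) ∧
    (ENNReal.ofReal (((2 : ℝ) ^ Nat.log 2 (k + 1))⁻¹ ^ 2 / 2) ≤
      P (unresolved X y k ∩ {ω | Separates t (ordered fun i => X i ω)}) →
      t ∈ dyadicGrid (Nat.log 2 (k + 1) + 1) ∧ ∀ j < k, y j ≠ t) := by
  set n := Nat.log 2 (k + 1) with hn
  have hcov := fun s hs => exists_eq_of_mem_dyadicGrid_log hy (s := s) hs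
  have hpos : ENNReal.ofReal (((2 : ℝ) ^ n)⁻¹ ^ 2 / 2) ≠ 0 :=
    (ENNReal.ofReal_pos.2 (by positivity)).ne'
  -- The point `1` has no cell to its right and separates almost no pair. Any other `t` lies in the
  -- cell found by rounding down, and the event is contained in the split of that cell at `t`.
  rcases ht.2.eq_or_lt with rfl | ht1
  · have : P (unresolved X y k ∩ {ω | Separates 1 (ordered fun i => X i ω)}) = 0 := by
      rw [measure_eq_zero_iff_ae_notMem]
      filter_upwards [hX.ae_mem_Ioc] with ω hω h
      exact absurd (max_le (hω 0).2 (hω 1).2) (not_le.2 h.2.2)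
    rw [this]
    exact ⟨zero_le, fun h => absurd (le_antisymm h zero_le) hpos⟩
  have h2 : (0 : ℝ) < 2 ^ n := by positivity
  have hf := Nat.floor_le (mul_nonneg ht.1 h2.le)
  have hf' := Nat.lt_floor_add_one (t * 2 ^ n)
  set i := ⌊t * 2 ^ n⌋₊
  have hi : i < 2 ^ n := by
    have : (i : ℝ) < ((2 ^ n : ℕ) : ℝ) := by
      push_cast
      exact hf.trans_lt (mul_lt_of_lt_one_left h2 ht1)
    exact_mod_cast this
  have hl : (i : ℝ) / 2 ^ n ≤ t := (div_le_iff₀ h2).2 hf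
  have hu : t < ((i : ℝ) + 1) / 2 ^ n := (lt_div_iff₀ h2).2 hf'
  obtain ⟨h0, hlt, h1, hlen⟩ := cell_bounds hi
  have hle : P (unresolved X y k ∩ {ω | Separates t (ordered fun i => X i ω)}) ≤
      P (split X ((i : ℝ) / 2 ^ n) t (((i : ℝ) + 1) / 2 ^ n)) := by
    refine measure_mono_ae ?_
    filter_upwards [hX.ae_mem_Ioc] with ω hω h
    exact mem_split_of_unresolved hcov hi hl hu hω h.1 h.2
  rw [← hlen]
  refine ⟨hle.trans (hX.prob_split_le h0 h1 le_rfl), fun h => ⟨?_, ?_⟩⟩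
  · rw [(hX.eq_midpoint_of_le_prob_split h0 hlt h1 le_rfl (h.trans hle)).1]
    exact odd_div_mem_dyadicGrid hi
  · rintro j hj rfl
    have : unresolved X y k ∩ {ω | Separates (y j) (ordered fun i => X i ω)} = ∅ :=
      Set.eq_empty_iff_forall_notMem.2 fun ω hω => hω.1 j hj hω.2
    rw [this, measure_empty, hlen] at h
    exact hpos (le_antisymm h zero_le)

lemma exists_mem_dyadicGrid_forall_ne {k : ℕ} (y : ℕ → ℝ) :
    ∃ t ∈ dyadicGrid (Nat.log 2 (k + 1) + 1), ∀ j < k, y j ≠ t := by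
  classical
  obtain ⟨t, ht, hne⟩ := Finset.exists_mem_notMem_of_card_lt_card
    (s := (Finset.range k).image y) (t := dyadicGrid (Nat.log 2 (k + 1) + 1)) (by
      refine Finset.card_image_le.trans_lt ?_
      rw [card_dyadicGrid, Finset.card_range]
      exact log_succ_lt_iff.1 (Nat.lt_succ_self _))
  exact ⟨t, ht, fun j hj e => hne (Finset.mem_image.2 ⟨j, Finset.mem_range.2 hj, e⟩)⟩

theorem IsUniformPair.isMPAThresholds_iff [IsProbabilityMeasure P] (hX : IsUniformPair P X) :
    IsMPAThresholds P X y ↔ ∀ k, IsDyadicStage y k := by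
  have key {k : ℕ} (hy : ∀ j < k, IsDyadicStage y j) :
      (y k ∈ Set.Icc (0 : ℝ) 1 ∧ ∀ t ∈ Set.Icc (0 : ℝ) 1,
        P[|unresolved X y k] {ω | Separates t (ordered fun i => X i ω)} ≤
        P[|unresolved X y k] {ω | Separates (y k) (ordered fun i => X i ω)}) ↔
      IsDyadicStage y k := by
    -- An untaken fine grid point serves twice: it shows that the conditioning event has positive
    -- probability and that the upper bound is attained.
    obtain ⟨t₀, ht₀, hne₀⟩ := exists_mem_dyadicGrid_forall_ne (k := k) y
    have hp₀ := hX.prob_unresolved_separates hy ht₀ hne₀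
    have hun : P (unresolved X y k) ≠ 0 := by
      refine ne_of_gt (lt_of_lt_of_le ?_ (measure_mono (Set.inter_subset_left
        (t := {ω | Separates t₀ (ordered fun i => X i ω)}))))
      rw [hp₀]
      exact ENNReal.ofReal_pos.2 (by positivity)
    have hm (t : ℝ) := (measurableSet_separates hX.measurable t).nullMeasurableSet (μ := P)
    simp only [fun t => cond_le_cond_iff hun (hm t) (hm (y k))]
    constructor
    · rintro ⟨hmem, hmax⟩
      have h := hmax t₀ (Set.Ioo_subset_Icc_self (mem_Ioo_of_mem_dyadicGrid ht₀))
      rw [hp₀] at h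
      exact (hX.prob_unresolved_separates_le hy hmem).2 h
    · rintro ⟨hmem, hne⟩
      refine ⟨Set.Ioo_subset_Icc_self (mem_Ioo_of_mem_dyadicGrid hmem), fun t ht => ?_⟩
      rw [hX.prob_unresolved_separates hy hmem hne]
      exact (hX.prob_unresolved_separates_le hy ht).1
  constructor
  · intro hM k
    induction k using Nat.strong_induction_on with
    | _ k ih => exact (key ih).1 (hM k)
  · exact fun hy k => (key fun j _ => hy j).2 (hy k)

end Thresholds

/-! ### The code of a dyadic enumeration -/

lemma firstThresholdCode_eq {y : ℕ → ℝ} {q : ℝ × ℝ} {k : ℕ} (hk : Separates (y k) q)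
    (hlt : ∀ j < k, ¬ Separates (y j) q) : firstThresholdCode y q = y k := by
  classical
  have hex : ∃ k, Separates (y k) q := ⟨k, hk⟩
  rw [firstThresholdCode, dif_pos hex]
  congr 1
  convert (Nat.find_eq_iff hex).2 ⟨hk, hlt⟩

lemma exists_first_separates {y : ℕ → ℝ} {q : ℝ × ℝ} (hex : ∃ k, Separates (y k) q) :
    ∃ k, Separates (y k) q ∧ ∀ j < k, ¬ Separates (y j) q := by
  classical
  exact ⟨Nat.find hex, Nat.find_spec hex, fun j hj => Nat.find_min hex hj⟩

lemma measurable_firstThresholdCode (y : ℕ → ℝ) : Measurable (firstThresholdCode y) := by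
  have hsep (k : ℕ) : MeasurableSet {q | Separates (y k) q} :=
    (measurableSet_le measurable_fst measurable_const).inter
      (measurableSet_lt measurable_const measurable_snd)
  have hfirst (k : ℕ) : MeasurableSet {q | Separates (y k) q ∧ ∀ j < k, ¬ Separates (y j) q} := by
    have : {q | Separates (y k) q ∧ ∀ j < k, ¬ Separates (y j) q} =
        {q | Separates (y k) q} ∩ ⋂ j, ⋂ (_ : j < k), {q | Separates (y j) q}ᶜ := by
      ext; simp
    rw [this]
    exact (hsep k).inter (MeasurableSet.iInter fun j => MeasurableSet.iInter fun _ => (hsep j).compl)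
  intro s hs
  have : firstThresholdCode y ⁻¹' s =
      (⋃ k, {q | Separates (y k) q ∧ ∀ j < k, ¬ Separates (y j) q} ∩ {_q | y k ∈ s}) ∪
      ((⋂ k, {q | Separates (y k) q}ᶜ) ∩ {_q | (0 : ℝ) ∈ s}) := by
    ext q
    simp only [Set.mem_preimage, Set.mem_union, Set.mem_iUnion, Set.mem_inter_iff,
      Set.mem_ofPred_eq, Set.mem_iInter, Set.mem_compl_iff]
    by_cases hex : ∃ k, Separates (y k) q
    · obtain ⟨k, hk⟩ := exists_first_separates hex
      rw [firstThresholdCode_eq hk.1 hk.2]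
      constructor
      · exact fun h => .inl ⟨k, hk, h⟩
      · rintro (⟨k', hk', h⟩ | ⟨h, -⟩)
        · rwa [← firstThresholdCode_eq hk.1 hk.2, firstThresholdCode_eq hk'.1 hk'.2]
        · exact absurd hk.1 (h k)
    · have h0 : firstThresholdCode y q = 0 := by rw [firstThresholdCode, dif_neg hex]
      rw [h0]
      push Not at hex
      constructor
      · exact fun h => .inr ⟨hex, h⟩
      · rintro (⟨k', hk', h⟩ | ⟨-, h⟩)
        · exact absurd hk'.1 (hex k')
        · exact h
  rw [this]
  exact (MeasurableSet.iUnion fun k => (hfirst k).inter (MeasurableSet.const _)).union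
    ((MeasurableSet.iInter fun k => (hsep k).compl).inter (MeasurableSet.const _))

lemma exists_separates_of_isDyadicStage {y : ℕ → ℝ} (hy : ∀ k, IsDyadicStage y k) {a b : ℝ}
    (ha : 0 ≤ a) (hab : a < b) (hb : b ≤ 1) : ∃ k, Separates (y k) (a, b) := by
  obtain ⟨n, t, ht, h1, h2⟩ := exists_mem_dyadicGrid_between ha hab hb
  obtain ⟨j, -, rfl⟩ := exists_eq_of_mem_dyadicGrid (fun j _ => hy j) ht
  exact ⟨j, h1.le, h2⟩

lemma isCode_firstThresholdCode {Ω : Type*} [MeasurableSpace Ω] (P : Measure Ω)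
    (X : Fin 2 → Ω → ℝ) {y : ℕ → ℝ} (hy : ∀ k, IsDyadicStage y k) :
    IsCode P X (firstThresholdCode y) where
  measurable := measurable_firstThresholdCode y
  separates a b ha hab hb := by
    obtain ⟨k, hk, hlt⟩ := exists_first_separates (exists_separates_of_isDyadicStage hy ha hab hb)
    rw [firstThresholdCode_eq hk hlt]
    exact hk
  discrete := by
    refine ⟨insert 0 (Set.range y), (Set.countable_range y).insert 0,
      Filter.Eventually.of_forall fun ω => ?_⟩
    rw [threshold, firstThresholdCode]
    split_ifs with h
    · exact .inr ⟨_, rfl⟩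
    · exact .inl rfl

/-- A bisecting strategy stops at the threshold assigned by the code of a dyadic enumeration. -/
lemma IsBisecting.fst_eq_firstThresholdCode {σ : Strategy} (hσ : IsBisecting σ) {y : ℕ → ℝ}
    (hy : ∀ k, IsDyadicStage y k) {x : Fin 2 → ℝ} (hx : ∀ i, x i ∈ Set.Ioc (0 : ℝ) 1) {n : ℕ}
    (hn : FirstSuccess σ x n) :
    (σ (history σ x n)).1 = firstThresholdCode y (ordered x) := by
  have hs := hn.success_notMem_history
  have hsep := (hσ.identifiesBest_and_separates hx hn).2
  have hmid := (hσ _ hs).1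
  have hbox := hσ.mem_bisectInterval hx hs
  obtain ⟨i, hi, e⟩ := exists_bisectInterval_eq hs
  rw [length_history] at hi e
  rw [e] at hmid hbox
  obtain ⟨m, hm, hym⟩ := exists_eq_of_mem_dyadicGrid (fun j _ => hy j) (odd_div_mem_dyadicGrid hi)
  simp only at hmid
  rw [← hmid] at hym
  obtain ⟨k, hk, hlt⟩ := exists_first_separates (y := y) (q := ordered x) ⟨m, by rwa [hym]⟩
  -- The stopping midpoint is itself taken at stage `m`, so the first separating threshold comes no
  -- later and lies in the same grid. It separates two gains of the current cell, hence lies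
  -- strictly inside it, where the midpoint is the only grid point.
  have hkm : k ≤ m := not_lt.1 fun h => hlt m h (by rwa [hym])
  rw [firstThresholdCode_eq hk hlt, hmid]
  exact (eq_midpoint_of_mem_dyadicGrid ((hy k).mem_dyadicGrid (hkm.trans_lt hm))
    ((lt_min (hbox 0).1 (hbox 1).1).trans_le hk.1)
    (hk.2.trans_le (max_le (hbox 0).2 (hbox 1).2))).symm

/-! ### The entropy of the dyadic code -/

/-- The contribution to the entropy of the `k`-th value of a dyadic enumeration. -/
def entropyTerm (k : ℕ) : ℝ :=
  (2 * (Nat.log 2 (k + 1) : ℝ) + 1) / 2 ^ (2 * Nat.log 2 (k + 1) + 1)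

/-- The `2^n` values of level `n` contribute `(2n+1)/2^(n+1)` in total, which telescopes as
`(2n+3)/2^n - (2n+5)/2^(n+1)`. -/
lemma sum_entropyTerm (n : ℕ) :
    ∑ k ∈ Finset.range (2 ^ n - 1), entropyTerm k = 3 - (2 * (n : ℝ) + 3) / 2 ^ n := by
  induction n with
  | zero => norm_num
  | succ n ih =>
    have hpos : 0 < 2 ^ n := by positivity
    have hle : 2 ^ n - 1 ≤ 2 ^ (n + 1) - 1 := by rw [pow_succ]; omega
    rw [← Finset.sum_range_add_sum_Ico _ hle, ih]
    have hterm : ∀ k ∈ Finset.Ico (2 ^ n - 1) (2 ^ (n + 1) - 1),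
        entropyTerm k = (2 * (n : ℝ) + 1) / 2 ^ (2 * n + 1) := by
      intro k hk
      rw [Finset.mem_Ico] at hk
      have : Nat.log 2 (k + 1) = n := by
        rw [Nat.log_eq_iff (.inr ⟨by norm_num, by omega⟩)]
        omega
      rw [entropyTerm, this]
    have hcard : 2 ^ (n + 1) - 1 - (2 ^ n - 1) = 2 ^ n := by rw [pow_succ]; omega
    rw [Finset.sum_congr rfl hterm, Finset.sum_const, Nat.card_Ico, hcard, nsmul_eq_mul]
    push_cast
    rw [show 2 * n + 1 = n + n + 1 by ring, pow_succ, pow_succ, pow_add]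
    field_simp
    ring

lemma entropyTerm_nonneg (k : ℕ) : 0 ≤ entropyTerm k := by unfold entropyTerm; positivity

lemma tsum_entropyTerm : ∑' k, ENNReal.ofReal (entropyTerm k) = 3 := by
  have hsub : Filter.Tendsto (fun n : ℕ => 2 ^ n - 1) Filter.atTop Filter.atTop :=
    Filter.tendsto_atTop_mono (fun n => Nat.le_sub_one_of_lt Nat.lt_two_pow_self) Filter.tendsto_id
  have h1 := (ENNReal.tendsto_nat_tsum fun k => ENNReal.ofReal (entropyTerm k)).comp hsub
  have h2 : Filter.Tendsto (fun n : ℕ => ENNReal.ofReal (3 - (2 * (n : ℝ) + 3) / 2 ^ n))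
      Filter.atTop (nhds (ENNReal.ofReal (3 - (2 * 0 + 3 * 0)))) := by
    refine ENNReal.tendsto_ofReal (Filter.Tendsto.const_sub 3 ?_)
    have hn := tendsto_self_mul_const_pow_of_lt_one (r := (2⁻¹ : ℝ)) (by norm_num) (by norm_num)
    have hp := tendsto_pow_atTop_nhds_zero_of_lt_one (r := (2⁻¹ : ℝ)) (by norm_num) (by norm_num)
    refine ((hn.const_mul 2).add (hp.const_mul 3)).congr fun n => ?_
    rw [inv_pow]
    field_simp
  have e : ENNReal.ofReal (3 - (2 * 0 + 3 * 0)) = 3 := by norm_num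
  rw [e] at h2
  refine tendsto_nhds_unique h1 (h2.congr fun n => ?_)
  rw [Function.comp, ← ENNReal.ofReal_sum_of_nonneg fun k _ => entropyTerm_nonneg k,
    sum_entropyTerm]

section Entropy

variable {Ω : Type*} [MeasurableSpace Ω] {P : Measure Ω} {X : Fin 2 → Ω → ℝ} {y : ℕ → ℝ}

lemma IsUniformPair.ae_exists_first_separates (hX : IsUniformPair P X)
    (hy : ∀ k, IsDyadicStage y k) :
    ∀ᵐ ω ∂P, ∃ k, Separates (y k) (ordered fun i => X i ω) ∧
      ∀ j < k, ¬ Separates (y j) (ordered fun i => X i ω) := by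
  filter_upwards [hX.ae_mem_Ioc, hX.ae_ne] with ω hω hne
  exact exists_first_separates (exists_separates_of_isDyadicStage hy
    (le_min (hω 0).1.le (hω 1).1.le) (min_lt_max.2 hne) (max_le (hω 0).2 (hω 1).2))

lemma IsUniformPair.prob_threshold_eq (hX : IsUniformPair P X) (hy : ∀ k, IsDyadicStage y k)
    (k : ℕ) :
    P.real (threshold X (firstThresholdCode y) ⁻¹' {y k}) =
      ((2 : ℝ) ^ (2 * Nat.log 2 (k + 1) + 1))⁻¹ := by
  have h : P (threshold X (firstThresholdCode y) ⁻¹' {y k}) =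
      P (unresolved X y k ∩ {ω | Separates (y k) (ordered fun i => X i ω)}) := by
    refine measure_congr ?_
    filter_upwards [hX.ae_exists_first_separates hy] with ω hω
    obtain ⟨j, hj, hlt⟩ := hω
    refine propext ⟨fun h => ?_, fun h => firstThresholdCode_eq h.2 h.1⟩
    have h' : firstThresholdCode y (ordered fun i => X i ω) = y k := h
    rw [firstThresholdCode_eq hj hlt] at h'
    obtain rfl := injective_of_isDyadicStage hy h'
    exact ⟨hlt, hj⟩
  rw [measureReal_def, h, hX.prob_unresolved_separates (fun j _ => hy j) (hy k).1 (hy k).2,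
    ENNReal.toReal_ofReal (by positivity), pow_succ 2 (2 * _), pow_mul']
  field_simp

theorem IsUniformPair.entropyBits_eq_three (hX : IsUniformPair P X)
    (hy : ∀ k, IsDyadicStage y k) :
    entropyBits P (threshold X (firstThresholdCode y)) = 3 := by
  -- Almost every pair is separated by some threshold, so the default value of the code carries no
  -- mass and the sum over all reals reduces to the terms of `y`.
  have hsupp : Function.support (fun t : ℝ => ENNReal.ofReal
      (-(P.real (threshold X (firstThresholdCode y) ⁻¹' {t}) *
        Real.logb 2 (P.real (threshold X (firstThresholdCode y) ⁻¹' {t}))))) ⊆ Set.range y := by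
    intro t ht
    by_contra hr
    refine ht ?_
    have : P (threshold X (firstThresholdCode y) ⁻¹' {t}) = 0 := by
      rw [measure_eq_zero_iff_ae_notMem]
      filter_upwards [hX.ae_exists_first_separates hy] with ω ⟨j, hj, hlt⟩ h
      exact hr ⟨j, (firstThresholdCode_eq hj hlt).symm.trans h⟩
    simp [measureReal_def, this]
  rw [entropyBits, ← (injective_of_isDyadicStage hy).tsum_eq hsupp, ← tsum_entropyTerm]
  refine tsum_congr fun k => ?_
  congr 1
  rw [hX.prob_threshold_eq hy k, entropyTerm, Real.logb_inv, ← Real.rpow_natCast,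
    Real.logb_rpow (by norm_num) (by norm_num)]
  push_cast
  field_simp

end Entropy

end Contention

end

theorem theorem2 {Ω : Type*} [MeasurableSpace Ω] (P : Measure Ω) [IsProbabilityMeasure P]
    (X : Fin 2 → Ω → ℝ) (hmeas : ∀ i, Measurable (X i))
    (hunif : ∀ i, pdf.IsUniform (X i) (Set.Icc (0 : ℝ) 1) P volume)
    (hindep : iIndepFun X P) :
    -- delay: the splitting algorithm is a maximal probability allocation strategy; every such
    -- strategy almost surely identifies the best user, with the minimal expected delay `2`
    (Contention.IsMPAStrategy P X (Contention.osa 2) ∧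
      (∀ σ, Contention.IsMPAStrategy P X σ →
        (∀ᵐ ω ∂P, ∃ n, Contention.FirstSuccess σ (fun i => X i ω) n ∧
          Contention.IdentifiesBest (σ (Contention.history σ (fun i => X i ω) n))
            (fun i => X i ω)) ∧
        Contention.expectedDelay P X σ = 2) ∧
      (∀ σ, 2 ≤ Contention.expectedDelay P X σ)) ∧
    -- entropy: maximal probability allocation gives the dyadic thresholds, and its code has the
    -- minimal entropy, `3` bits
    (Contention.IsMPAThresholds P X Contention.dyadicThreshold ∧
      (∀ y, Contention.IsMPAThresholds P X y →
        Set.range y = Set.range Contention.dyadicThreshold ∧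
        Contention.IsCode P X (Contention.firstThresholdCode y) ∧
        Contention.entropyBits P
          (Contention.threshold X (Contention.firstThresholdCode y)) = 3) ∧
      (∀ C, Contention.IsCode P X C →
        3 ≤ Contention.entropyBits P (Contention.threshold X C))) ∧
    -- it is the same scheme: the strategy stops at the threshold that the code assigns
    (∀ σ y, Contention.IsMPAStrategy P X σ → Contention.IsMPAThresholds P X y →
      ∀ᵐ ω ∂P, ∀ n, Contention.FirstSuccess σ (fun i => X i ω) n →
        (σ (Contention.history σ (fun i => X i ω) n)).1 =
          Contention.threshold X (Contention.firstThresholdCode y) ω) := by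
  have hX := Contention.isUniformPair_of_iIndepFun hmeas hunif hindep
  simp only [hX.isMPAStrategy_iff, hX.isMPAThresholds_iff]
  refine ⟨⟨Contention.isBisecting_osa_two, fun σ hσ => ⟨?_, hX.expectedDelay_eq_two hσ⟩,
    hX.two_le_expectedDelay⟩, ⟨Contention.isDyadicStage_dyadicThreshold, fun y hy =>
    ⟨?_, Contention.isCode_firstThresholdCode P X hy, hX.entropyBits_eq_three hy⟩,
    fun C hC => Contention.three_le_entropyBits_of_isCode hX hC⟩, fun σ y hσ hy => ?_⟩
  · filter_upwards [hX.ae_mem_Ioc, hX.ae_ne] with ω hω hne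
    obtain ⟨n, hn⟩ := hσ.exists_firstSuccess hω hne
    exact ⟨n, hn, (hσ.identifiesBest_and_separates hω hn).1⟩
  · rw [Contention.range_eq_iUnion_dyadicGrid hy,
      Contention.range_eq_iUnion_dyadicGrid Contention.isDyadicStage_dyadicThreshold]
  · filter_upwards [hX.ae_mem_Ioc] with ω hω n hn
    exact hσ.fst_eq_firstThresholdCode hy hω hn
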